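/- Let $r\ge 1$, let $p_1\ge p_2\ge\dots\ge p_r>0$ be integers with $p_1>1$, and let $r_1$ be the multiplicity of the largest part $p_1$. Let $\underline{t}=(t^{(a)}_j)_{1\le a\le r,\ j\ge 1}$ be time variables, and for $\underline m\in\mathbb Z^r$ put $|\underline m|_a=m_1+\dots+m_a$ and $|\underline m|=|\underline m|_r$; let $\underline e_a$ be the standard basis of $\mathbb Z^r$. Put $$e_+^{(a)}(\underline t,z)=\exp\Big(\sum_{j\ge1}z^jt^{(a)}_j\Big),\qquad e_-^{(a)}\Big(\frac{\partial}{\partial\underline t},z\Big)=\exp\Big(-\sum_{j\ge1}\frac{z^{-j}}{j}\frac{\partial}{\partial t^{(a)}_j}\Big).$$ A tau-function of charge $k\in\mathbb Z$ of the $\underline p$-reduced $r$-component KP hierarchy is a family of complex valued functions $\tau^{\underline m}(\underline t)$, $|\underline m|=k$, smooth in all the times, such that for all $\ell\ge0$ and all $\underline m',\underline m''\in\mathbb Z^r$ with $|\underline m'|=k+1$, $|\underline m''|=k-1$, $$\mathrm{Res}_z\sum_{a=1}^r(-1)^{|\underline m'+\underline m''|_{a-1}}z^{m'_a-m''_a+\ell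 p_a-2}\,e_+^{(a)}(\underline t'-\underline t'',z)\,e_-^{(a)}\Big(\frac{\partial}{\partial\underline t'}-\frac{\partial}{\partial\underline t''},z\Big)\tau^{\underline m'-\underline e_a}(\underline t')\,\tau^{\underline m''+\underline e_a}(\underline t'')=0,$$ meaning that one gets $0$ after applying any finite product of derivatives $\partial/\partial t'^{(b)}_j$ inside the residue and then setting $\underline t'=\underline t''$. Let such a tau-function be given, and let $|\underline m|=k$. Define the $r\times r$ matrices $P^\pm(\underline m,\underline t,z)$ by $$P^{\pm}_{ab}(\underline m,\underline t,\pm z)=(-1)^{|\underline e_a|_{b-1}}\frac{z^{\delta_{ab}-1}}{\tau^{\underline m}(\underline t)}\,e_-^{(b)}\Big(\pm\frac{\partial}{\partial\underline t},z\Big)\tau^{\underline m\pm\underline e_a\mp\underline e_b}(\underline t).$$ Let $Q^\pm(x)=Q^\pm(\underline m,x,\underline t,z)$ be obtained from $P^\pm(\underline m,\underline t,z)$ by setting $t^{(a)}_j=0$ for all $a>r_1$, $j\ge1$, and then replacing $t_1^{(a)}$ by $t_1^{(a)}+x$ for all $a\le r_1$; write $Q^\pm_{ab}=\delta_{ab}+\sum_{j\ge1}Q^\pm_{ab;j}z^{-j}$.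 Everything is considered where $\tau^{\underline m}$, at the times so reduced and translated, is defined and nonzero. There the $Q^\pm_{ab;j}$ are smooth functions of $x$; put $\partial=\partial_x$ and consider pseudodifferential operators in $\partial$ whose coefficients are smooth functions of $x$. The lower indices $\pm$ of an operator denote its differential part and the rest. Let $Q^+_{\mathbf1\mathbf1}(\partial)$ be the $r_1\times r_1$ matrix pseudodifferential operator with symbol $(Q^+_{ab})_{a,b\le r_1}$. It is invertible, and we put $$\mathcal L_a=Q^+_{\mathbf1\mathbf1}(\partial)\circ E_{aa}\partial\circ Q^+_{\mathbf1\mathbf1}(\partial)^{-1}\ (1\le a\le r_1),\qquad \widetilde{\mathcal L}=\sum_{a=1}^{r_1}\mathcal L_a^{p_1}.$$ Let $\widetilde W_{\mathbf1\mathbf2}=(\widetilde W_{ab})_{a\le r_1<b}$ and $\widetilde W_{\mathbf2\mathbf1}=(\widetilde W_{ab})_{b\le r_1<a}$ with $$\widetilde W_{ab}=\sum_{j=0}^{p_b-1}\sum_{i=0}^j\frac{(-x)^i}{i!}Q^+_{ab;j-i+1}\,\partial^j\quad(a\le r_1<b),\qquad \widetilde W_{ab}=-\sum_{j=0}^{p_a-1}\sum_{i=0}^j(-\partial)^j\circ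 Q^-_{ba;j-i+1}\frac{(-x)^i}{i!}\quad(b\le r_1<a),$$ and let $$\widetilde W_{\mathbf1\mathbf1}=\widetilde{\mathcal L}_+-\mathbb 1_{r_1}\partial^{p_1}+\Big(\widetilde W_{\mathbf1\mathbf2}\circ\Big(\sum_{a=r_1+1}^rE_{aa}\partial^{-p_a}\Big)\circ\widetilde W_{\mathbf2\mathbf1}\Big)_+.$$ Then $$\widetilde{\mathcal L}=\mathbb 1_{r_1}\partial^{p_1}+\widetilde W_{\mathbf1\mathbf1}-\widetilde W_{\mathbf1\mathbf2}\circ\Big(\sum_{a=r_1+1}^rE_{aa}\partial^{-p_a}\Big)\circ\widetilde W_{\mathbf2\mathbf1},$$ and $\widetilde W_{\mathbf1\mathbf1},\widetilde W_{\mathbf1\mathbf2},\widetilde W_{\mathbf2\mathbf1}$ are matrices of differential operators: the entries of $\widetilde W_{\mathbf1\mathbf1}$ have order at most $p_1-1$, and $\widetilde W_{ab}$, for $a\le r_1<b$ or $b\le r_1<a$, has order at most $\min\{p_a,p_b\}-1$. -/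

import Mathlib

/-- Underlying additive group of `R((∂⁻¹))`: families of coefficients indexed by the power of `∂`
which vanish for all sufficiently large powers. -/
def PDO.carrier (R : Type*) [CommRing R] : AddSubgroup (ℤ → R) where
  carrier := {f | ∃ N : ℤ, ∀ n, N < n → f n = 0}
  zero_mem' := ⟨0, fun _ _ => rfl⟩
  add_mem' := by
    rintro f g ⟨N, hN⟩ ⟨M, hM⟩
    exact ⟨max N M, fun n hn => by
      simp [hN n (lt_of_le_of_lt (le_max_left _ _) hn), hM n (lt_of_le_of_lt (le_max_right _ _) hn)]⟩
  neg_mem' := by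
    rintro f ⟨N, hN⟩
    exact ⟨N, fun n hn => by simp [hN n hn]⟩

/-- The scalar pseudodifferential operators `∑_{n ≤ N} aₙ ∂ⁿ` over the differential ring `R`. -/
def PDO (R : Type*) [CommRing R] : Type _ := PDO.carrier R

namespace PDO

section Basic

variable {R : Type*} [CommRing R]

instance : AddCommGroup (PDO R) := inferInstanceAs (AddCommGroup (PDO.carrier R))

/-- The coefficient of `∂ⁿ`. -/
def coeff (a : PDO R) (n : ℤ) : R := a.1 n

@[ext]
theorem ext {a b : PDO R} (h : ∀ n, a.coeff n = b.coeff n) : a = b :=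
  Subtype.ext (funext h)

@[simp] theorem coeff_add (a b : PDO R) (n : ℤ) : (a + b).coeff n = a.coeff n + b.coeff n := rfl
@[simp] theorem coeff_zero (n : ℤ) : (0 : PDO R).coeff n = 0 := rfl
@[simp] theorem coeff_neg (a : PDO R) (n : ℤ) : (-a).coeff n = -a.coeff n := rfl

/-- `a` has order at most `N`. -/
def OrderLE (a : PDO R) (N : ℤ) : Prop := ∀ n, N < n → a.coeff n = 0

theorem exists_orderLE (a : PDO R) : ∃ N, a.OrderLE N := a.2

theorem OrderLE.mono {a : PDO R} {N M : ℤ} (h : a.OrderLE N) (hNM : N ≤ M) : a.OrderLE M :=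
  fun n hn => h n (lt_of_le_of_lt hNM hn)

/-- `a` is a differential operator: only nonnegative powers of `∂` occur. -/
def IsDifferential (a : PDO R) : Prop := ∀ n, n < 0 → a.coeff n = 0

/-- The operator `f ∂ⁿ`. -/
def monomial (n : ℤ) (f : R) : PDO R :=
  ⟨fun k => if k = n then f else 0, n, fun _ hk => if_neg hk.ne'⟩

@[simp] theorem coeff_monomial (n : ℤ) (f : R) (k : ℤ) :
    (monomial n f).coeff k = if k = n then f else 0 := rfl

theorem OrderLE.add {a b : PDO R} {A : ℤ} (ha : a.OrderLE A) (hb : b.OrderLE A) :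
    (a + b).OrderLE A := fun n hn => by simp [ha n hn, hb n hn]

theorem ext_of_orderLE {a b : PDO R} {A : ℤ} (ha : a.OrderLE A) (hb : b.OrderLE A)
    (h : ∀ N : ℕ, a.coeff (A - N) = b.coeff (A - N)) : a = b := by
  ext n
  by_cases hn : A < n
  · rw [ha n hn, hb n hn]
  · have := h (A - n).toNat
    rwa [show A - ((A - n).toNat : ℤ) = n by omega] at this

theorem exists_common (a b c : PDO R) : ∃ N, a.OrderLE N ∧ b.OrderLE N ∧ c.OrderLE N := by
  obtain ⟨A, hA⟩ := a.exists_orderLE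
  obtain ⟨B, hB⟩ := b.exists_orderLE
  obtain ⟨C, hC⟩ := c.exists_orderLE
  exact ⟨max A (max B C), hA.mono (by simp), hB.mono (by simp), hC.mono (by simp)⟩

instance : One (PDO R) := ⟨monomial 0 1⟩

theorem coeff_one (n : ℤ) : (1 : PDO R).coeff n = if n = 0 then 1 else 0 := rfl

/-- The differential part `a₊`. -/
def plus (a : PDO R) : PDO R :=
  ⟨fun n => if 0 ≤ n then a.coeff n else 0, by
    obtain ⟨N, hN⟩ := a.exists_orderLE
    exact ⟨N, fun n hn => by simp [hN n hn]⟩⟩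

/-- The operator `∑_{n ≥ 0} fₙ ∂⁻ⁿ` with symbol `∑_{n ≥ 0} fₙ z⁻ⁿ`. -/
def ofSeries (f : ℕ → R) : PDO R :=
  ⟨fun n => if n ≤ 0 then f (-n).toNat else 0, 0, fun _ hn => if_neg (not_le.2 hn)⟩

end Basic

section Mul

variable {R : Type*} [CommRing R] [Differential R]

/-- The coefficient of `∂ⁿ` in `a ∘ b`, from the rule
`∂ⁱ ∘ f = ∑_{k ≥ 0} binom(i, k) f⁽ᵏ⁾ ∂ⁱ⁻ᵏ` for `i ∈ ℤ`; all but finitely many terms vanish. -/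
noncomputable def mulCoeff (a b : PDO R) (n : ℤ) : R :=
  ∑ᶠ q : ℤ × ℕ, Ring.choose q.1 q.2 •
    (a.coeff q.1 * (Differential.deriv)^[q.2] (b.coeff (n - q.1 + q.2)))

theorem iter_add (k : ℕ) (f g : R) :
    (Differential.deriv)^[k] (f + g)
      = (Differential.deriv)^[k] f + (Differential.deriv)^[k] g :=
  iterate_map_add _ _ _ _

theorem iter_zero (k : ℕ) : (Differential.deriv)^[k] (0 : R) = 0 :=
  iterate_map_zero _ _

theorem iter_sum {ι : Type*} (s : Finset ι) (f : ι → R) (k : ℕ) :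
    (Differential.deriv)^[k] (∑ i ∈ s, f i) = ∑ i ∈ s, (Differential.deriv)^[k] (f i) := by
  classical
  induction s using Finset.induction_on with
  | empty => simp
  | insert a s ha ih => rw [Finset.sum_insert ha, Finset.sum_insert ha, iter_add, ih]

theorem iter_smul (k : ℕ) (c : ℤ) (f : R) :
    (Differential.deriv)^[k] (c • f) = c • (Differential.deriv)^[k] f := by
  induction k generalizing f with
  | zero => rfl
  | succ k ih => rw [Function.iterate_succ_apply, map_zsmul, ih, Function.iterate_succ_apply]

theorem iter_mul (k : ℕ) (f g : R) :
    (Differential.deriv)^[k] (f * g) = ∑ q ∈ Finset.HasAntidiagonal.antidiagonal k,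
      k.choose q.1 • ((Differential.deriv)^[q.1] f * (Differential.deriv)^[q.2] g) := by
  induction k with
  | zero => simp
  | succ k ih =>
    rw [Function.iterate_succ_apply', ih, map_sum]
    rw [Finset.sum_antidiagonal_choose_succ_nsmul
      (fun i j => (Differential.deriv)^[i] f * (Differential.deriv)^[j] g) k]
    rw [← Finset.sum_add_distrib]
    refine Finset.sum_congr rfl fun q hq => ?_
    rw [k.choose_symm_of_eq_add (Finset.HasAntidiagonal.mem_antidiagonal.1 hq).symm, map_nsmul,
      Derivation.leibniz, ← smul_add]
    simp only [smul_eq_mul, Function.iterate_succ_apply']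
    congr 1
    ring

theorem mulCoeff_eq {a b : PDO R} {A B : ℤ} (ha : a.OrderLE A) (hb : b.OrderLE B) (N : ℕ) :
    mulCoeff a b (A + B - N) =
      ∑ q ∈ Finset.HasAntidiagonal.antidiagonal N, ∑ s ∈ Finset.HasAntidiagonal.antidiagonal q.2,
        Ring.choose (A - q.1) s.2 •
          (a.coeff (A - q.1) * (Differential.deriv)^[s.2] (b.coeff (B - s.1))) := by
  rw [Finset.sum_sigma']
  unfold mulCoeff
  rw [← finsum_mem_univ, finsum_mem_eq_sum_of_inter_support_eq
    (t := ((Finset.HasAntidiagonal.antidiagonal N).sigma fun q => Finset.HasAntidiagonal.antidiagonal q.2).image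
      fun w => ((A - w.1.1 : ℤ), w.2.2))]
  · rw [Finset.sum_image]
    · refine Finset.sum_congr rfl fun w hw => ?_
      simp only [Finset.mem_sigma, Finset.HasAntidiagonal.mem_antidiagonal] at hw
      congr 4
      omega
    · rintro ⟨⟨u, w⟩, v, k⟩ h ⟨⟨u', w'⟩, v', k'⟩ h' he
      simp only [Finset.coe_sigma, Set.mem_sigma_iff, Finset.mem_coe,
        Finset.HasAntidiagonal.mem_antidiagonal, Prod.mk.injEq] at h h' he
      obtain ⟨h1, h2⟩ := h
      obtain ⟨h3, h4⟩ := h'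
      obtain ⟨h5, h6⟩ := he
      have e1 : u = u' := by omega
      have e2 : w = w' := by omega
      have e3 : v = v' := by omega
      subst e1 e2 e3 h6
      rfl
  · ext ⟨i, k⟩
    simp only [Set.univ_inter, Function.mem_support, Set.mem_inter_iff,
      Finset.coe_image, Set.mem_image, Finset.mem_coe, Finset.mem_sigma, Finset.HasAntidiagonal.mem_antidiagonal]
    constructor
    · intro h
      refine ⟨?_, h⟩
      have h1 : i ≤ A := by
        by_contra hc
        exact h (by rw [ha i (by omega)]; simp)
      have h2 : A + B - N - i + k ≤ B := by
        by_contra hc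
        exact h (by rw [hb _ (by omega), iter_zero]; simp)
      refine ⟨⟨((A - i).toNat, N - (A - i).toNat), (N - (A - i).toNat - k, k)⟩, ⟨?_, ?_⟩, ?_⟩
      · simp; omega
      · simp; omega
      · simp; omega
    · exact fun h => h.2

theorem mulCoeff_eq_zero {a b : PDO R} {A B : ℤ} (ha : a.OrderLE A) (hb : b.OrderLE B) (n : ℤ)
    (hn : A + B < n) : mulCoeff a b n = 0 := by
  unfold mulCoeff
  refine finsum_eq_zero_of_forall_eq_zero ?_
  rintro ⟨i, k⟩
  by_cases h : A < i
  · simp [ha i h]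
  · rw [hb _ (by simp only; omega), iter_zero]; simp

noncomputable instance : Mul (PDO R) :=
  ⟨fun a b => ⟨mulCoeff a b, by
    obtain ⟨A, hA⟩ := a.exists_orderLE
    obtain ⟨B, hB⟩ := b.exists_orderLE
    exact ⟨A + B, fun n hn => mulCoeff_eq_zero hA hB n hn⟩⟩⟩

theorem coeff_mul (a b : PDO R) (n : ℤ) : (a * b).coeff n = mulCoeff a b n := rfl

theorem OrderLE.mul {a b : PDO R} {A B : ℤ} (ha : a.OrderLE A) (hb : b.OrderLE B) :
    (a * b).OrderLE (A + B) := fun n hn => mulCoeff_eq_zero ha hb n hn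

theorem coeff_mul_of_le {a b : PDO R} {A B : ℤ} (ha : a.OrderLE A) (hb : b.OrderLE B) (N : ℕ) :
    (a * b).coeff (A + B - N) =
      ∑ q ∈ Finset.HasAntidiagonal.antidiagonal N, ∑ s ∈ Finset.HasAntidiagonal.antidiagonal q.2,
        Ring.choose (A - q.1) s.2 •
          (a.coeff (A - q.1) * (Differential.deriv)^[s.2] (b.coeff (B - s.1))) :=
  mulCoeff_eq ha hb N

theorem mul_add' (a b c : PDO R) : a * (b + c) = a * b + a * c := by
  obtain ⟨N, hA, hB, hC⟩ := exists_common a b c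
  refine ext_of_orderLE (hA.mul (hB.add hC)) ((hA.mul hB).add (hA.mul hC)) fun n => ?_
  rw [coeff_add, coeff_mul_of_le hA (hB.add hC), coeff_mul_of_le hA hB, coeff_mul_of_le hA hC]
  simp only [coeff_add, iter_add, mul_add, smul_add, Finset.sum_add_distrib]

theorem add_mul' (a b c : PDO R) : (a + b) * c = a * c + b * c := by
  obtain ⟨N, hA, hB, hC⟩ := exists_common a b c
  refine ext_of_orderLE ((hA.add hB).mul hC) ((hA.mul hC).add (hB.mul hC)) fun n => ?_
  rw [coeff_add, coeff_mul_of_le (hA.add hB) hC, coeff_mul_of_le hA hC, coeff_mul_of_le hB hC]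
  simp only [coeff_add, add_mul, smul_add, Finset.sum_add_distrib]

theorem choose_identity (α β : ℤ) (s L : ℕ) :
    ∑ q ∈ Finset.HasAntidiagonal.antidiagonal L,
        Ring.choose α (s + q.1) * ((s + q.1).choose s : ℤ) * Ring.choose β q.2
      = Ring.choose α s * Ring.choose (α + β - s) L := by
  rw [show α + β - (s : ℤ) = (α - s) + β by ring, Ring.add_choose_eq L (Commute.all _ _),
    Finset.mul_sum]
  refine Finset.sum_congr rfl fun q _ => ?_
  have h := Ring.choose_smul_choose α (n := s + q.1) (k := s) (by omega)
  simp only [nsmul_eq_mul, Nat.add_sub_cancel_left] at h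
  rw [← mul_assoc, ← h]
  ring

theorem mul_assoc' (a b c : PDO R) : a * b * c = a * (b * c) := by
  obtain ⟨A, hA⟩ := a.exists_orderLE
  obtain ⟨B, hB⟩ := b.exists_orderLE
  obtain ⟨C, hC⟩ := c.exists_orderLE
  refine ext_of_orderLE (A := A + B + C) ((hA.mul hB).mul hC)
    ((hA.mul (hB.mul hC)).mono (by omega)) fun N => ?_
  rw [coeff_mul_of_le (hA.mul hB) hC, add_assoc, coeff_mul_of_le hA (hB.mul hC)]
  simp only [coeff_mul_of_le hA hB, coeff_mul_of_le hB hC, iter_sum, iter_smul, iter_mul,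
    Finset.smul_sum, Finset.mul_sum, Finset.sum_mul, Finset.sum_sigma']
  trans ∑ x ∈ (Finset.HasAntidiagonal.antidiagonal N).sigma fun a =>
      (Finset.HasAntidiagonal.antidiagonal a.2).sigma fun _ =>
        (Finset.HasAntidiagonal.antidiagonal a.1).sigma fun a =>
          Finset.HasAntidiagonal.antidiagonal a.2,
      ∑ z ∈ Finset.HasAntidiagonal.antidiagonal x.2.1.2,
        (Ring.choose (A - x.2.2.1.1) (x.2.2.2.2 + z.1) *
          ((x.2.2.2.2 + z.1).choose x.2.2.2.2 : ℤ) * Ring.choose (B - x.2.2.2.1) z.2) •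
        (a.coeff (A - x.2.2.1.1) *
          (Differential.deriv)^[x.2.2.2.2] (b.coeff (B - x.2.2.2.1)) *
          (Differential.deriv)^[z.1 + z.2] (c.coeff (C - x.2.1.1)))
  · refine Finset.sum_congr rfl fun x hx => ?_
    simp only [Finset.mem_sigma, Finset.HasAntidiagonal.mem_antidiagonal] at hx
    obtain ⟨-, -, h3, h4⟩ := hx
    have hu : A + B - (x.1.1 : ℤ) = (A - x.2.2.1.1) + (B - x.2.2.2.1) - x.2.2.2.2 := by omega
    trans ∑ z ∈ Finset.HasAntidiagonal.antidiagonal x.2.1.2,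
        (Ring.choose (A - x.2.2.1.1) (x.2.2.2.2 + z.1) *
          ((x.2.2.2.2 + z.1).choose x.2.2.2.2 : ℤ) * Ring.choose (B - x.2.2.2.1) z.2) •
        (a.coeff (A - x.2.2.1.1) *
          (Differential.deriv)^[x.2.2.2.2] (b.coeff (B - x.2.2.2.1)) *
          (Differential.deriv)^[x.2.1.2] (c.coeff (C - x.2.1.1)))
    · rw [← Finset.sum_smul, choose_identity, ← hu, mul_smul, smul_mul_assoc, smul_comm]
    · refine Finset.sum_congr rfl fun z hz => ?_
      rw [Finset.HasAntidiagonal.mem_antidiagonal.1 hz]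
  · rw [Finset.sum_sigma']
    refine Finset.sum_nbij'
      (fun x => ⟨(x.1.2.2.1.1, N - x.1.2.2.1.1),
        (x.1.2.2.2.1 + x.1.2.1.1 + x.2.2, x.1.2.2.2.2 + x.2.1),
        ⟨(x.1.2.2.2.1, x.1.2.1.1 + x.2.2), (x.1.2.1.1, x.2.2)⟩, (x.1.2.2.2.2, x.2.1)⟩)
      (fun y => ⟨⟨(y.1.1 + y.2.2.1.1.1 + y.2.2.2.1,
          N - (y.1.1 + y.2.2.1.1.1 + y.2.2.2.1)),
        (y.2.2.1.2.1, y.2.2.2.2 + y.2.2.1.2.2),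
        (y.1.1, y.2.2.1.1.1 + y.2.2.2.1), (y.2.2.1.1.1, y.2.2.2.1)⟩,
        (y.2.2.2.2, y.2.2.1.2.2)⟩) ?_ ?_ ?_ ?_ ?_
    · rintro ⟨⟨⟨u, w⟩, ⟨v, L⟩, ⟨i, y⟩, ⟨j, s⟩⟩, ⟨q, l⟩⟩ h
      simp only [Finset.mem_sigma, Finset.HasAntidiagonal.mem_antidiagonal] at h ⊢
      refine ⟨?_, ?_, ⟨?_, ?_⟩, ?_⟩ <;> (try dsimp only at *) <;> omega
    · rintro ⟨⟨i, w⟩, ⟨y, K⟩, ⟨⟨j, y'⟩, ⟨v, l⟩⟩, ⟨s, q⟩⟩ h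
      simp only [Finset.mem_sigma, Finset.HasAntidiagonal.mem_antidiagonal] at h ⊢
      refine ⟨⟨?_, ?_, ?_, ?_⟩, ?_⟩ <;> (try dsimp only at *) <;> omega
    · rintro ⟨⟨⟨u, w⟩, ⟨v, L⟩, ⟨i, y⟩, ⟨j, s⟩⟩, ⟨q, l⟩⟩ h
      simp only [Finset.mem_sigma, Finset.HasAntidiagonal.mem_antidiagonal] at h ⊢
      obtain ⟨⟨h1, h2, h3, h4⟩, h5⟩ := h
      subst h5 h4 h3 h2
      simp only [Sigma.mk.injEq, Prod.mk.injEq, heq_eq_eq, and_true]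
      omega
    · rintro ⟨⟨i, w⟩, ⟨y, K⟩, ⟨⟨j, y'⟩, ⟨v, l⟩⟩, ⟨s, q⟩⟩ h
      simp only [Finset.mem_sigma, Finset.HasAntidiagonal.mem_antidiagonal] at h ⊢
      obtain ⟨h1, h2, ⟨h3, h4⟩, h5⟩ := h
      subst h5 h4 h3 h2
      simp only [Sigma.mk.injEq, Prod.mk.injEq, heq_eq_eq, and_true, true_and]
      omega
    · rintro ⟨⟨⟨u, w⟩, ⟨v, L⟩, ⟨i, y⟩, ⟨j, s⟩⟩, ⟨q, l⟩⟩ h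
      simp only [zsmul_eq_mul, nsmul_eq_mul, Function.iterate_add_apply]
      push_cast
      ring

theorem iter_one (k : ℕ) : (Differential.deriv)^[k] (1 : R) = if k = 0 then 1 else 0 := by
  cases k with
  | zero => rfl
  | succ k => rw [Function.iterate_succ_apply, Derivation.map_one_eq_zero, iter_zero]; simp

theorem one_mul' (a : PDO R) : 1 * a = a := by
  ext n
  rw [coeff_mul, mulCoeff, finsum_eq_single _ ((0 : ℤ), 0)]
  · simp [coeff_one]
  · rintro ⟨i, k⟩ h
    by_cases hi : i = 0
    · subst hi
      have hk : 0 < k := Nat.pos_of_ne_zero fun hk => h (by rw [hk])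
      simp [Ring.choose_zero_pos ℤ hk]
    · simp [coeff_one, hi]

theorem mul_one' (a : PDO R) : a * 1 = a := by
  ext n
  rw [coeff_mul, mulCoeff, finsum_eq_single _ (n, 0)]
  · simp [coeff_one]
  · rintro ⟨i, k⟩ h
    by_cases hk : n - i + k = 0
    · have hk0 : k ≠ 0 := by
        rintro rfl
        exact h (by rw [show i = n by simpa [sub_eq_zero, eq_comm] using hk])
      simp [coeff_one, hk, iter_one, hk0]
    · simp [coeff_one, hk]

noncomputable instance : Ring (PDO R) where
  __ := (inferInstance : AddCommGroup (PDO R))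
  left_distrib := mul_add'
  right_distrib := add_mul'
  zero_mul a := by simpa using add_mul' 0 0 a
  mul_zero a := by simpa using mul_add' a 0 0
  mul_assoc := mul_assoc'
  one_mul := one_mul'
  mul_one := mul_one'

end Mul

end PDO

open scoped ContDiff Topology

/-! ### Smooth functions of the space variable -/

section SmoothFun

variable {𝕜 : Type*} [RCLike 𝕜] [NormedAlgebra 𝕜 ℂ]

/-- The `ℂ`-algebra of smooth complex valued functions on an open subset `U` of the line `𝕜`. -/
def smoothFun (U : TopologicalSpace.Opens 𝕜) : Subalgebra ℂ (U → ℂ) where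
  carrier := {f | ∃ g : 𝕜 → ℂ, ContDiffOn 𝕜 ∞ g U ∧ ∀ u : U, f u = g u}
  mul_mem' := by
    rintro f₁ f₂ ⟨g₁, h₁, e₁⟩ ⟨g₂, h₂, e₂⟩
    exact ⟨fun x => g₁ x * g₂ x, h₁.mul h₂, fun u => by simp [e₁, e₂]⟩
  add_mem' := by
    rintro f₁ f₂ ⟨g₁, h₁, e₁⟩ ⟨g₂, h₂, e₂⟩
    exact ⟨fun x => g₁ x + g₂ x, h₁.add h₂, fun u => by simp [e₁, e₂]⟩
  algebraMap_mem' c := ⟨fun _ => c, contDiffOn_const, fun _ => rfl⟩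

namespace smoothFun

variable {U : TopologicalSpace.Opens 𝕜}

/-- Extension of `f : U → ℂ` by zero. -/
noncomputable def zeroExt (f : U → ℂ) : 𝕜 → ℂ := Function.extend Subtype.val f 0

theorem zeroExt_apply (f : U → ℂ) (u : U) : zeroExt f u = f u :=
  Subtype.val_injective.extend_apply f 0 u

theorem contDiffOn_zeroExt (f : smoothFun U) : ContDiffOn 𝕜 ∞ (zeroExt f.1) U := by
  obtain ⟨f, g, hg, e⟩ := f
  exact hg.congr fun x hx => (zeroExt_apply f ⟨x, hx⟩).trans (e ⟨x, hx⟩)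

theorem differentiableAt_zeroExt (f : smoothFun U) (u : U) :
    DifferentiableAt 𝕜 (zeroExt f.1) u :=
  ((contDiffOn_zeroExt f).contDiffAt (U.isOpen.mem_nhds u.2)).differentiableAt (by simp)

theorem zeroExt_eventuallyEq (f : U → ℂ) (g : 𝕜 → ℂ) (e : ∀ u : U, f u = g u) (u : U) :
    zeroExt f =ᶠ[𝓝 (u : 𝕜)] g := by
  filter_upwards [U.isOpen.mem_nhds u.2] with x hx
  exact (zeroExt_apply f ⟨x, hx⟩).trans (e ⟨x, hx⟩)

/-- The derivation `∂ = d/dx`. -/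
noncomputable instance : Differential (smoothFun U) where
  deriv := Derivation.mk'
    { toFun := fun f => ⟨fun u => deriv (zeroExt f.1) (u : 𝕜), deriv (zeroExt f.1),
        (contDiffOn_zeroExt f).deriv_of_isOpen U.isOpen (by simp), fun _ => rfl⟩
      map_add' := fun f g => by
        refine Subtype.ext (funext fun u => ?_)
        change deriv (zeroExt (f.1 + g.1)) (u : 𝕜)
          = deriv (zeroExt f.1) (u : 𝕜) + deriv (zeroExt g.1) (u : 𝕜)
        rw [← deriv_add (differentiableAt_zeroExt f u) (differentiableAt_zeroExt g u)]
        refine (zeroExt_eventuallyEq _ _ (fun v => ?_) u).deriv_eq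
        simp [zeroExt_apply]
      map_smul' := fun c f => by
        refine Subtype.ext (funext fun u => ?_)
        change deriv (zeroExt (c • f.1)) (u : 𝕜) = c • deriv (zeroExt f.1) (u : 𝕜)
        rw [zsmul_eq_mul (deriv (zeroExt f.1) (u : 𝕜)) c,
          ← deriv_const_mul (c : ℂ) (differentiableAt_zeroExt f u)]
        refine (zeroExt_eventuallyEq _ _ (fun v => ?_) u).deriv_eq
        simp [zeroExt_apply] }
    (fun f g => by
      refine Subtype.ext (funext fun u => ?_)
      change deriv (zeroExt (f.1 * g.1)) (u : 𝕜)
        = f.1 u * deriv (zeroExt g.1) (u : 𝕜) + g.1 u * deriv (zeroExt f.1) (u : 𝕜)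
      have h : deriv (zeroExt (f.1 * g.1)) (u : 𝕜) = deriv (zeroExt f.1 * zeroExt g.1) (u : 𝕜) := by
        refine (zeroExt_eventuallyEq _ _ (fun v => ?_) u).deriv_eq
        simp [zeroExt_apply]
      rw [h, deriv_mul (differentiableAt_zeroExt f u) (differentiableAt_zeroExt g u),
        zeroExt_apply, zeroExt_apply]
      ring)

/-- The coordinate function `x`. -/
noncomputable def X (U : TopologicalSpace.Opens 𝕜) : smoothFun U :=
  ⟨fun u => algebraMap 𝕜 ℂ u, fun x => algebraMap 𝕜 ℂ x,
    (algebraMapCLM 𝕜 ℂ).contDiff.contDiffOn, fun _ => rfl⟩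

end smoothFun

end SmoothFun

/-! ### Functions of the times -/

/-- The space of times `t = (t_j^{(a)})`, with `a ∈ {1, …, r}` and `j ∈ ℤ_{>0}`. -/
abbrev Times (𝕜 : Type*) (r : ℕ) : Type _ := Fin r × ℕ+ → 𝕜

section Times

variable {𝕜 : Type*} [RCLike 𝕜] [NormedAlgebra 𝕜 ℂ] {r : ℕ}

/-- Change of the finitely many times in `S` by the increments `s`. -/
def Times.shift (t : Times 𝕜 r) (S : Finset (Fin r × ℕ+)) (s : S → 𝕜) : Times 𝕜 r :=
  fun i => t i + if h : i ∈ S then s ⟨i, h⟩ else 0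

/-- `D` is open in each finite set of times, the other times being fixed. -/
def Times.FinOpen (D : Set (Times 𝕜 r)) : Prop :=
  ∀ t ∈ D, ∀ S : Finset (Fin r × ℕ+), ∀ᶠ s : S → 𝕜 in 𝓝 0, t.shift S s ∈ D

/-- `f` is smooth on `D` in all the time variables: jointly smooth in each finite set of times,
the other times being fixed. -/
def SmoothInTimes (D : Set (Times 𝕜 r)) (f : Times 𝕜 r → ℂ) : Prop :=
  ∀ t ∈ D, ∀ S : Finset (Fin r × ℕ+), ContDiffAt 𝕜 ∞ (fun s : S → 𝕜 => f (t.shift S s)) 0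

/-- The partial derivative `∂f/∂t_j^{(a)}`, where `i = (a, j)`. -/
noncomputable def timeDeriv (i : Fin r × ℕ+) (f : Times 𝕜 r → ℂ) : Times 𝕜 r → ℂ :=
  fun t => deriv (fun h : 𝕜 => f (t + Pi.single i h)) 0

/-- The coefficient of `z⁻ⁿ` in `e_-^{(a)}(ε ∂/∂t, z) f = exp(-∑_{j ≥ 1} (z^{-j}/j) ε ∂/∂t_j^{(a)}) f`.
It is the sum over all `(j₁, …, jₗ)` with `j₁ + ⋯ + jₗ = n` of
`(1/l!) ∏ᵢ (-(ε/jᵢ) ∂/∂t_{jᵢ}^{(a)}) f`. -/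
noncomputable def eMinus (ε : ℤˣ) (a : Fin r) (n : ℕ) (f : Times 𝕜 r → ℂ) : Times 𝕜 r → ℂ :=
  fun t => ∑ c : Composition n, (1 / (c.length.factorial : ℂ)) *
    c.blocks.foldr
      (fun (j : ℕ) g => fun t' => -(((ε : ℤ) : ℂ) / (j : ℂ)) * timeDeriv (a, j.toPNat') g t') f t

theorem SmoothInTimes.timeDeriv {D : Set (Times 𝕜 r)} {f : Times 𝕜 r → ℂ}
    (hf : SmoothInTimes D f) (i : Fin r × ℕ+) : SmoothInTimes D (timeDeriv i f) := by
  classical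
  intro t ht S
  have hF := hf t ht (insert i S)
  set F : (↥(insert i S : Finset (Fin r × ℕ+)) → 𝕜) → ℂ := fun s => f (t.shift (insert i S) s)
  let E : (S → 𝕜) →L[𝕜] (↥(insert i S : Finset (Fin r × ℕ+)) → 𝕜) :=
    ContinuousLinearMap.pi fun q =>
      if h : (q : Fin r × ℕ+) ∈ S then ContinuousLinearMap.proj ⟨q, h⟩ else 0
  let v : (↥(insert i S : Finset (Fin r × ℕ+)) → 𝕜) := Pi.single ⟨i, Finset.mem_insert_self i S⟩ 1
  have hE : ∀ s q, E s q = if h : (q : Fin r × ℕ+) ∈ S then s ⟨q, h⟩ else 0 := by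
    intro s q
    by_cases h : (q : Fin r × ℕ+) ∈ S <;> simp [E, h]
  have key : ∀ (s : S → 𝕜) (h : 𝕜), f (t.shift S s + Pi.single i h) = F (E s + h • v) := by
    intro s h
    refine congrArg f (funext fun q => ?_)
    by_cases hq : q = i
    · subst hq
      simp [Times.shift, hE, v, add_assoc]
    · by_cases hS : q ∈ S <;> simp [Times.shift, hE, v, hq, hS, Subtype.ext_iff]
  have hE0 : E 0 = 0 := map_zero E
  have hd : ∀ᶠ s in 𝓝 (0 : S → 𝕜), DifferentiableAt 𝕜 F (E s) := by
    have h1 : ∀ᶠ y in 𝓝 (E 0), ContDiffAt 𝕜 1 F y := by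
      rw [hE0]
      exact (hF.of_le (by simp)).eventually (by simp)
    filter_upwards [E.continuous.continuousAt.eventually h1] with s hs
    exact hs.differentiableAt (by simp)
  have hsm : ContDiffAt 𝕜 ∞ (fun s => fderiv 𝕜 F (E s) v) 0 := by
    have h2 : ContDiffAt 𝕜 ∞ (fderiv 𝕜 F) (E 0) := by
      rw [hE0]; exact hF.fderiv_right (by simp)
    exact (h2.comp (0 : S → 𝕜) E.contDiff.contDiffAt).clm_apply contDiffAt_const
  refine hsm.congr_of_eventuallyEq ?_
  filter_upwards [hd] with s hs
  change deriv (fun h : 𝕜 => f (t.shift S s + Pi.single i h)) 0 = _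
  simp only [key]
  have hl : HasDerivAt (fun h : 𝕜 => E s + h • v) v 0 := by
    simpa using ((hasDerivAt_id (0 : 𝕜)).smul_const v).const_add (E s)
  have hs' : HasFDerivAt F (fderiv 𝕜 F (E s)) (E s + (0 : 𝕜) • v) := by
    simpa using hs.hasFDerivAt
  exact (hs'.comp_hasDerivAt (0 : 𝕜) hl).deriv

theorem SmoothInTimes.eMinus {D : Set (Times 𝕜 r)} {f : Times 𝕜 r → ℂ}
    (hf : SmoothInTimes D f) (ε : ℤˣ) (a : Fin r) (n : ℕ) :
    SmoothInTimes D (eMinus ε a n f) := by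
  intro t ht S
  refine ContDiffAt.sum fun c _ => contDiffAt_const.mul ?_
  have h : ∀ l : List ℕ, SmoothInTimes D (l.foldr
      (fun (j : ℕ) g => fun t' => -(((ε : ℤ) : ℂ) / (j : ℂ)) * _root_.timeDeriv (a, j.toPNat') g t') f) := by
    intro l
    induction l with
    | nil => exact hf
    | cons j l ih => exact fun t ht S => contDiffAt_const.mul ((ih.timeDeriv (a, j.toPNat')) t ht S)
  exact h _ t ht S

end Times

/-! ### Tau-functions -/

/-- A tau-function of charge `k`: functions `τ^m` of the times, for `m ∈ ℤʳ` with `|m| = k`,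
smooth in all the times. (The values `toFun m` with `|m| ≠ k` are never used.) -/
structure TauFunction (𝕜 : Type*) [RCLike 𝕜] [NormedAlgebra 𝕜 ℂ] (r : ℕ) (k : ℤ) where
  /-- The common domain of definition of the functions. -/
  domain : Set (Times 𝕜 r)
  finOpen : Times.FinOpen domain
  /-- The functions `τ^m`. -/
  toFun : (Fin r → ℤ) → Times 𝕜 r → ℂ
  smooth : ∀ m : Fin r → ℤ, ∑ a, m a = k → SmoothInTimes domain (toFun m)

namespace TauFunction

variable {𝕜 : Type*} [RCLike 𝕜] [NormedAlgebra 𝕜 ℂ] {r : ℕ} {k : ℤ}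

/-- The vector `e_a` of the standard basis of `ℤʳ`. -/
def stdVec (a : Fin r) : Fin r → ℤ := Pi.single a 1

/-- The coefficient of `zⁿ` in `e_-^{(a)}(∂/∂t' - ∂/∂t'', z) τ^{m'}(t') τ^{m''}(t'')`, which is
`(e_-^{(a)}(∂/∂t', z) τ^{m'}(t')) (e_-^{(a)}(-∂/∂t'', z) τ^{m''}(t''))`,
as a function of `t'` for fixed `t''`. -/
noncomputable def pairCoeff (τ : TauFunction 𝕜 r k) (a : Fin r) (m' m'' : Fin r → ℤ)
    (t'' : Times 𝕜 r) (n : ℤ) : Times 𝕜 r → ℂ :=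
  fun t' => if n ≤ 0 then
    ∑ q ∈ Finset.HasAntidiagonal.antidiagonal (-n).toNat,
      eMinus 1 a q.1 (τ.toFun m') t' * eMinus (-1) a q.2 (τ.toFun m'') t''
  else 0

/-- For a Laurent series `G = ∑ₙ Gₙ(t') zⁿ` one has
`∂/∂t'_j^{(b)} (e_+^{(a)}(t' - t'', z) G) = e_+^{(a)}(t' - t'', z) (∂G/∂t'_j^{(b)} + δ_{ab} zʲ G)`;
this is the operator `G ↦ ∂G/∂t'_j^{(b)} + δ_{ab} zʲ G`, for `i = (b, j)`. -/
noncomputable def twistedDeriv (a : Fin r) (i : Fin r × ℕ+) (G : ℤ → Times 𝕜 r → ℂ) :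
    ℤ → Times 𝕜 r → ℂ :=
  fun n t' => timeDeriv i (G n) t' + if i.1 = a then G (n - (i.2 : ℕ)) t' else 0

/-- The `p`-KdV bilinear equation
`Res_z ∑_a (-1)^{|m' + m''|_{a-1}} z^{m'_a - m''_a + ℓ p_a - 2} e_+^{(a)}(t' - t'', z)
  e_-^{(a)}(∂/∂t' - ∂/∂t'', z) τ^{m' - e_a}(t') τ^{m'' + e_a}(t'') = 0`
for `ℓ ≥ 0`, `|m'| = k + 1`, `|m''| = k - 1`. Its meaning is: for each finite family `l` of times,
apply the derivatives with respect to these times of `t'` inside the residue, and then set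
`t' = t'' = t` (so that `e_+^{(a)}(t' - t'', z)` becomes `1`). -/
def IsPKdV (τ : TauFunction 𝕜 r k) (p : Fin r → ℕ) : Prop :=
  ∀ (ℓ : ℕ) (m' m'' : Fin r → ℤ), ∑ a, m' a = k + 1 → ∑ a, m'' a = k - 1 →
    ∀ l : List (Fin r × ℕ+), ∀ t ∈ τ.domain,
      ∑ a : Fin r, (-1 : ℂ) ^ (∑ b ∈ Finset.univ.filter (fun b => b < a), (m' b + m'' b)) *
        l.foldr (twistedDeriv a) (τ.pairCoeff a (m' - stdVec a) (m'' + stdVec a) t)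
          (-1 - (m' a - m'' a + ℓ * p a - 2)) t = 0

/-- The coefficient of `z⁻ⁿ` in `P^ε_{ab}(m, t, z)`, for `ε = ±1`, where
`P^±_{ab}(m, t, ±z) = (-1)^{|e_a|_{b-1}} (z^{δ_{ab}-1} / τ^m(t)) e_-^{(b)}(±∂/∂t, z) τ^{m ± e_a ∓ e_b}(t)`.
-/
noncomputable def PCoeff (τ : TauFunction 𝕜 r k) (ε : ℤˣ) (m : Fin r → ℤ) (a b : Fin r) (n : ℕ)
    (t : Times 𝕜 r) : ℂ :=
  ((ε : ℤ) : ℂ) ^ n * (if a < b then -1 else 1) *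
    ((if a = b then eMinus ε b n (τ.toFun (m + (ε : ℤ) • (stdVec a - stdVec b))) t
      else if n = 0 then 0
      else eMinus ε b (n - 1) (τ.toFun (m + (ε : ℤ) • (stdVec a - stdVec b))) t) / τ.toFun m t)

section Reduction

variable [NeZero r]

/-- The indices `a` with `p_a = p_1`; as `p` is decreasing, these are `1, …, r_1`. -/
abbrev Top (p : Fin r → ℕ) : Type := {a : Fin r // p a = p 0}

/-- The indices `a` with `p_a ≠ p_1`; as `p` is decreasing, these are `r_1 + 1, …, r`. -/
abbrev Rest (p : Fin r → ℕ) : Type := {a : Fin r // p a ≠ p 0}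

/-- The times `t|_{t^{(a)} = 0 for a > r_1}`, with `t_1^{(a)}` translated by `x` for `a ≤ r_1`. -/
def reducedTimes (p : Fin r → ℕ) (t : Times 𝕜 r) (x : 𝕜) : Times 𝕜 r :=
  fun i => if p i.1 = p 0 then t i + (if i.2 = 1 then x else 0) else 0

/-- The finite set of the times `t_1^{(a)}` with `a ≤ r_1`. -/
def shiftedTimes (p : Fin r → ℕ) : Finset (Fin r × ℕ+) :=
  (Finset.univ.filter fun a => p a = p 0) ×ˢ {1}

theorem mem_shiftedTimes (p : Fin r → ℕ) (i : Fin r × ℕ+) :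
    i ∈ shiftedTimes p ↔ p i.1 = p 0 ∧ i.2 = 1 := by
  rw [shiftedTimes, Finset.mem_product, Finset.mem_filter, Finset.mem_singleton]
  simp

theorem reducedTimes_eq_shift (p : Fin r → ℕ) (t : Times 𝕜 r) (x y : 𝕜) :
    reducedTimes p t y = (reducedTimes p t x).shift (shiftedTimes p) (fun _ => y - x) := by
  funext i
  by_cases h1 : p i.1 = p 0 <;> by_cases h2 : i.2 = 1 <;>
    simp [reducedTimes, Times.shift, mem_shiftedTimes, h1, h2]

theorem contDiffAt_reducedTimes {D : Set (Times 𝕜 r)} {f : Times 𝕜 r → ℂ}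
    (hf : SmoothInTimes D f) (p : Fin r → ℕ) (t : Times 𝕜 r) (x : 𝕜)
    (hx : reducedTimes p t x ∈ D) : ContDiffAt 𝕜 ∞ (fun y => f (reducedTimes p t y)) x := by
  have e : (fun y => f (reducedTimes p t y)) = (fun s : shiftedTimes p → 𝕜 =>
      f ((reducedTimes p t x).shift (shiftedTimes p) s)) ∘ (fun y _ => y - x) :=
    funext fun y => congrArg f (reducedTimes_eq_shift p t x y)
  have h := hf _ hx (shiftedTimes p)
  have h' : ContDiffAt 𝕜 ∞ (fun (y : 𝕜) (_ : shiftedTimes p) => y - x) x := by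
    fun_prop
  have h0 : (fun _ => x - x : shiftedTimes p → 𝕜) = 0 := by
    funext; exact sub_self x
  rw [e]
  refine ContDiffAt.comp x ?_ h'
  rw [h0]
  exact h

/-- The set of all `x` such that `τ^m` is defined and nonzero at the reduced times translated
by `x`. -/
def region (τ : TauFunction 𝕜 r k) (p : Fin r → ℕ) (m : Fin r → ℤ) (hm : ∑ a, m a = k)
    (t : Times 𝕜 r) : TopologicalSpace.Opens 𝕜 where
  carrier := {x | reducedTimes p t x ∈ τ.domain ∧ τ.toFun m (reducedTimes p t x) ≠ 0}
  is_open' := by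
    rw [isOpen_iff_mem_nhds]
    rintro x ⟨hx, hx0⟩
    have h1 : ∀ᶠ y in 𝓝 x, reducedTimes p t y ∈ τ.domain := by
      have h := τ.finOpen _ hx (shiftedTimes p)
      have hc : ContinuousAt (fun (y : 𝕜) (_ : shiftedTimes p) => y - x) x := by
        fun_prop
      have h0 : (fun _ => x - x : shiftedTimes p → 𝕜) = 0 := by
        funext; exact sub_self x
      rw [← h0] at h
      filter_upwards [hc.eventually h] with y hy
      rwa [reducedTimes_eq_shift p t x y]
    have h2 := (contDiffAt_reducedTimes (τ.smooth m hm) p t x hx).continuousAt.eventually_ne hx0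
    filter_upwards [h1, h2] with y hy hy' using ⟨hy, hy'⟩

theorem sum_shift (ε : ℤˣ) (m : Fin r → ℤ) (hm : ∑ a, m a = k) (a b : Fin r) :
    ∑ c, (m + (ε : ℤ) • (stdVec a - stdVec b)) c = k := by
  simp [Finset.sum_add_distrib, hm, ← Finset.mul_sum, stdVec]

/-- `Q^ε_{ab;n}(m, x, t)`, the coefficient of `z⁻ⁿ` in `Q^ε_{ab}(m, x, t, z)`, as a smooth function
of `x`. -/
noncomputable def Q (τ : TauFunction 𝕜 r k) (p : Fin r → ℕ) (m : Fin r → ℤ) (hm : ∑ a, m a = k)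
    (t : Times 𝕜 r) (ε : ℤˣ) (a b : Fin r) (n : ℕ) : smoothFun (τ.region p m hm t) :=
  ⟨fun x => τ.PCoeff ε m a b n (reducedTimes p t x),
    fun x => τ.PCoeff ε m a b n (reducedTimes p t x), by
      rintro x ⟨hx, hx0⟩
      have h := τ.smooth _ (sum_shift ε m hm a b)
      simp only [PCoeff, div_eq_mul_inv]
      refine ContDiffAt.contDiffWithinAt (contDiffAt_const.mul (ContDiffAt.mul ?_
        ((contDiffAt_reducedTimes (τ.smooth m hm) p t x hx).inv hx0)))
      split_ifs
      · exact contDiffAt_reducedTimes (h.eMinus ε b n) p t x hx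
      · exact contDiffAt_const
      · exact contDiffAt_reducedTimes (h.eMinus ε b (n - 1)) p t x hx, fun _ => rfl⟩

variable (τ : TauFunction 𝕜 r k) (p : Fin r → ℕ) (m : Fin r → ℤ) (hm : ∑ a, m a = k)
  (t : Times 𝕜 r)

/-- The operator `Q⁺₁₁(m, x, t, ∂)`. -/
noncomputable def Q11 : Matrix (Top p) (Top p) (PDO (smoothFun (τ.region p m hm t))) :=
  Matrix.of fun a b => PDO.ofSeries fun n => τ.Q p m hm t 1 a b n

/-- The reduced Lax operators `L_a = Q⁺₁₁ ∘ E_{aa} ∂ ∘ (Q⁺₁₁)⁻¹`, for `a ≤ r_1`. -/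
noncomputable def lax (a : Top p) :
    Matrix (Top p) (Top p) (PDO (smoothFun (τ.region p m hm t))) :=
  τ.Q11 p m hm t * Matrix.single a a (PDO.monomial 1 1) * Ring.inverse (τ.Q11 p m hm t)

/-- The operator `L̃ = ∑_{a ≤ r_1} L_a^{p_1}`. -/
noncomputable def laxTilde : Matrix (Top p) (Top p) (PDO (smoothFun (τ.region p m hm t))) :=
  ∑ a : Top p, τ.lax p m hm t a ^ p 0

/-- The function `(-x)ⁱ / i!`. -/
noncomputable def expCoeff (i : ℕ) : smoothFun (τ.region p m hm t) :=
  ((i.factorial : ℂ)⁻¹) • (-smoothFun.X (τ.region p m hm t)) ^ i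

/-- The operator `W̃₁₂`, with entries
`∑_{j < p_b} ∑_{i ≤ j} ((-x)ⁱ / i!) Q⁺_{ab; j-i+1} ∂ʲ`. -/
noncomputable def W12 : Matrix (Top p) (Rest p) (PDO (smoothFun (τ.region p m hm t))) :=
  Matrix.of fun a b => ∑ j ∈ Finset.range (p b), ∑ i ∈ Finset.range (j + 1),
    PDO.monomial j (τ.expCoeff p m hm t i * τ.Q p m hm t 1 a b (j - i + 1))

/-- The operator `W̃₂₁`, with entries
`-∑_{j < p_a} ∑_{i ≤ j} (-∂)ʲ ∘ Q⁻_{ba; j-i+1} ((-x)ⁱ / i!)`. -/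
noncomputable def W21 : Matrix (Rest p) (Top p) (PDO (smoothFun (τ.region p m hm t))) :=
  Matrix.of fun a b => -∑ j ∈ Finset.range (p a), ∑ i ∈ Finset.range (j + 1),
    (-PDO.monomial 1 1) ^ j *
      PDO.monomial 0 (τ.Q p m hm t (-1) b a (j - i + 1) * τ.expCoeff p m hm t i)

/-- The operator `∑_{a > r_1} E_{aa} ∂^{-p_a}`. -/
noncomputable def middle : Matrix (Rest p) (Rest p) (PDO (smoothFun (τ.region p m hm t))) :=
  Matrix.diagonal fun a => PDO.monomial (-(p a : ℤ)) 1

/-- The operator `𝟙 ∂^{p_1}`. -/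
noncomputable def leadingTerm : Matrix (Top p) (Top p) (PDO (smoothFun (τ.region p m hm t))) :=
  Matrix.diagonal fun _ => PDO.monomial (p 0 : ℤ) 1

/-- The operator `W̃₁₁ = L̃₊ - 𝟙 ∂^{p_1} + (W̃₁₂ ∘ (∑_{a > r_1} E_{aa} ∂^{-p_a}) ∘ W̃₂₁)₊`. -/
noncomputable def W11 : Matrix (Top p) (Top p) (PDO (smoothFun (τ.region p m hm t))) :=
  (τ.laxTilde p m hm t).map PDO.plus - τ.leadingTerm p m hm t +
    (τ.W12 p m hm t * τ.middle p m hm t * τ.W21 p m hm t).map PDO.plus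

end Reduction

end TauFunction

/-!
Translating the first times of the top components by `x` multiplies `e₊(t' - t'', z)` there by
`e^{(x' - x'')z}`. The `ℓ`-th bilinear equation together with its derivatives in `x'` thus says that
the coefficient of `∂⁻¹` in `∂^N ∘ τ A` vanishes for all `N`, which makes
`A = Q⁺₁₁ ∂^{ℓp₁} (Q⁻₁₁)* + ∑_{c > r₁} [z^{ℓp_c + 1}] F_c(z) ∂⁻¹ G_c(z)ᵀ`
a differential operator, where `F_c` and `G_c` are the `c`-th columns of `Q⁺(z⁻¹)` and `Q⁻(-z⁻¹)`.
For `ℓ = 0` the second summand is zero, and comparing orders gives `(Q⁺₁₁)⁻¹ = (Q⁻₁₁)*`. For `ℓ = 1`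
the first summand is then `L̃`. In the second one, write `F_c = e^{xz} (e^{-xz} F_c)` and
`G_c = e^{-xz} (e^{xz} G_c)`: since `e^{xz} ∂⁻¹ e^{-xz} = (∂ - z)⁻¹`, it equals `W̃₁₂ ∂^{-p} W̃₂₁`
up to a differential operator. Hence `L̃ + W̃₁₂ ∂^{-p} W̃₂₁` is differential, and so equal to its
own differential part.
-/

open scoped PowerSeries

namespace PDO

section Basic

variable {R : Type*} [CommRing R]

theorem coeff_sub (a b : PDO R) (n : ℤ) : (a - b).coeff n = a.coeff n - b.coeff n := rfl

theorem coeff_sum {ι : Type*} (s : Finset ι) (f : ι → PDO R) (n : ℤ) :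
    (∑ i ∈ s, f i).coeff n = ∑ i ∈ s, (f i).coeff n :=
  map_sum (⟨⟨fun a : PDO R => a.coeff n, rfl⟩, fun _ _ => rfl⟩ : PDO R →+ R) f s

/-- The filtration of `PDO R` by the order: the operators of order at most `N`. -/
def filtration (R : Type*) [CommRing R] (N : ℤ) : AddSubgroup (PDO R) where
  carrier := {a | a.OrderLE N}
  add_mem' := OrderLE.add
  zero_mem' _ _ := rfl
  neg_mem' {a} ha n hn := by rw [coeff_neg, ha n hn, neg_zero]

theorem orderLE_monomial (n : ℤ) (f : R) : (monomial n f).OrderLE n :=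
  fun _ hk => if_neg hk.ne'

theorem isDifferential_monomial {n : ℤ} (hn : 0 ≤ n) (f : R) : (monomial n f).IsDifferential :=
  fun _ hk => if_neg (hk.trans_le hn).ne

theorem monomial_sum {ι : Type*} (s : Finset ι) (n : ℤ) (f : ι → R) :
    monomial n (∑ i ∈ s, f i) = ∑ i ∈ s, monomial n (f i) := by
  ext k
  simp only [coeff_sum, coeff_monomial]
  split_ifs <;> simp

theorem coeff_plus (a : PDO R) (n : ℤ) : a.plus.coeff n = if 0 ≤ n then a.coeff n else 0 := rfl

theorem isDifferential_plus (a : PDO R) : a.plus.IsDifferential :=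
  fun _ hn => if_neg hn.not_ge

theorem OrderLE.plus {a : PDO R} {N : ℤ} (ha : a.OrderLE N) : a.plus.OrderLE N :=
  fun n hn => by rw [coeff_plus, ha n hn, ite_self]

theorem plus_add (a b : PDO R) : (a + b).plus = a.plus + b.plus := by
  ext n
  simp only [coeff_plus, coeff_add]
  split_ifs <;> simp

theorem IsDifferential.plus_eq {a : PDO R} (ha : a.IsDifferential) : a.plus = a := by
  ext n
  rw [coeff_plus]
  split_ifs with hn
  · rfl
  · exact (ha n (not_le.1 hn)).symm

theorem IsDifferential.eq_zero_of_orderLE {a : PDO R} (ha : a.IsDifferential)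
    (ha' : a.OrderLE (-1)) : a = 0 := by
  ext n
  obtain hn | hn := lt_or_ge n 0
  · exact ha n hn
  · exact ha' n (by omega)

theorem eq_zero_of_forall_orderLE {a : PDO R} (ha : ∀ N : ℕ, a.OrderLE (-N)) : a = 0 := by
  ext n
  exact ha (-n + 1).toNat n (by omega)

end Basic

section Ring

variable {R : Type*} [CommRing R] [Differential R]

theorem coeff_monomial_zero_mul (f : R) (a : PDO R) (n : ℤ) :
    (monomial 0 f * a).coeff n = f * a.coeff n := by
  rw [coeff_mul, mulCoeff, finsum_eq_single _ ((0 : ℤ), 0)]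
  · simp
  · rintro ⟨i, k⟩ hne
    obtain rfl | hi := eq_or_ne i 0
    · have hk : 0 < k := Nat.pos_of_ne_zero fun hk => hne (by rw [hk])
      simp [Ring.choose_zero_pos ℤ hk]
    · simp [hi]

theorem coeff_mul_monomial_one (a : PDO R) (s n : ℤ) :
    (a * monomial s 1).coeff n = a.coeff (n - s) := by
  rw [coeff_mul, mulCoeff, finsum_eq_single _ (n - s, 0)]
  · simp
  · rintro ⟨i, k⟩ hne
    by_cases hk : n - i + k = s
    · have hk0 : k ≠ 0 := by
        rintro rfl
        exact hne (by rw [show i = n - s by simp at hk; omega])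
      simp [hk, iter_one, hk0]
    · simp [hk]

theorem monomial_mul_monomial_one (i j : ℤ) (f : R) :
    monomial i f * monomial j 1 = monomial (i + j) f := by
  ext n
  simp only [coeff_mul_monomial_one, coeff_monomial, sub_eq_iff_eq_add]

/-- The operator `∂`, as a unit of the ring of pseudodifferential operators. -/
noncomputable def D (R : Type*) [CommRing R] [Differential R] : (PDO R)ˣ where
  val := monomial 1 1
  inv := monomial (-1) 1
  val_inv := monomial_mul_monomial_one _ _ _
  inv_val := monomial_mul_monomial_one _ _ _

theorem coe_D_zpow (n : ℤ) : ((D R ^ n : (PDO R)ˣ) : PDO R) = monomial n 1 := by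
  induction n with
  | zero => rfl
  | succ n ih => rw [zpow_add_one, Units.val_mul, ih]; exact monomial_mul_monomial_one _ _ _
  | pred n ih => rw [zpow_sub_one, Units.val_mul, ih]; exact monomial_mul_monomial_one _ _ _

theorem coe_D_pow (n : ℕ) : (D R : PDO R) ^ n = monomial n 1 := by
  rw [← Units.val_pow_eq_pow_val, ← zpow_natCast, coe_D_zpow]

theorem coeff_D_mul (a : PDO R) (n : ℤ) :
    (D R * a).coeff n = Differential.deriv (a.coeff n) + a.coeff (n - 1) := by
  change (monomial 1 1 * a).coeff n = _
  rw [coeff_mul, mulCoeff, finsum_eq_sum_of_support_subset (s := {((1 : ℤ), 0), ((1 : ℤ), 1)})]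
  · rw [Finset.sum_pair (by simp)]
    simp [add_comm]
  · rintro ⟨i, k⟩ hne
    rw [Function.mem_support] at hne
    obtain rfl : i = 1 := by
      by_contra hi
      exact hne (by simp [hi])
    have hk : k < 2 := by
      by_contra hk
      have := Ring.choose_natCast (R := ℤ) 1 k
      rw [Nat.choose_eq_zero_of_lt (by omega), Nat.cast_one, Nat.cast_zero] at this
      exact hne (by simp [this])
    interval_cases k <;> simp

theorem IsDifferential.mul {a b : PDO R} (ha : a.IsDifferential) (hb : b.IsDifferential) :
    (a * b).IsDifferential := by
  intro n hn
  rw [coeff_mul, mulCoeff]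
  refine finsum_eq_zero_of_forall_eq_zero fun ⟨i, k⟩ => ?_
  by_cases hi : i < 0
  · simp [ha i hi]
  by_cases hk : n - i + k < 0
  · simp [hb _ hk]
  have := Ring.choose_natCast (R := ℤ) i.toNat k
  rw [Nat.choose_eq_zero_of_lt (by omega), show ((i.toNat : ℕ) : ℤ) = i by omega] at this
  simp [this]

/-- The subring of differential operators. -/
def differentialSubring (R : Type*) [CommRing R] [Differential R] : Subring (PDO R) where
  carrier := {a | a.IsDifferential}
  mul_mem' := IsDifferential.mul
  one_mem' := isDifferential_monomial le_rfl 1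
  add_mem' {a b} ha hb n hn := by rw [coeff_add, ha n hn, hb n hn, add_zero]
  zero_mem' _ _ := rfl
  neg_mem' {a} ha n hn := by rw [coeff_neg, ha n hn, neg_zero]

theorem isDifferential_D_pow (n : ℕ) : ((D R : PDO R) ^ n).IsDifferential :=
  pow_mem (S := differentialSubring R) (isDifferential_monomial zero_le_one 1) n

/-- The multiplication operator `f`, of order `0`. -/
noncomputable def C : R →+* PDO R where
  toFun := monomial 0
  map_one' := rfl
  map_mul' f g := by
    ext n
    rw [coeff_monomial_zero_mul]
    simp
  map_zero' := by ext n; simp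
  map_add' f g := by
    ext n
    simp only [coeff_add, coeff_monomial]
    split_ifs <;> simp

theorem C_apply (f : R) : C f = monomial 0 f := rfl

theorem coeff_C_mul (f : R) (a : PDO R) (n : ℤ) : (C f * a).coeff n = f * a.coeff n :=
  coeff_monomial_zero_mul f a n

theorem C_mul_monomial_one (f : R) (n : ℤ) : C f * monomial n 1 = monomial n f := by
  rw [C_apply, monomial_mul_monomial_one, zero_add]

theorem isDifferential_C (f : R) : (C f).IsDifferential := isDifferential_monomial le_rfl f

theorem orderLE_C (f : R) : (C f).OrderLE 0 := orderLE_monomial 0 f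

theorem D_mul_C (f : R) : D R * C f = C (Differential.deriv f) + C f * D R := by
  ext n
  change (_ : R) = (C (Differential.deriv f) + C f * monomial 1 1 : PDO R).coeff n
  rw [coeff_D_mul, C_mul_monomial_one, C_apply, C_apply]
  simp only [coeff_monomial, coeff_add, apply_ite Differential.deriv, map_zero, sub_eq_zero]

theorem commute_monomial_one {a : PDO R} (ha : ∀ n, Differential.deriv (a.coeff n) = 0) (n : ℤ) :
    Commute (monomial n 1) a := by
  have hD : Commute (D R : PDO R) a := by
    ext n
    rw [coeff_D_mul, ha, zero_add]
    exact (coeff_mul_monomial_one a 1 n).symm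
  exact coe_D_zpow (R := R) n ▸ hD.units_zpow_left n

theorem monomial_one_mul_C {f : R} (hf : Differential.deriv f = 0) (n : ℤ) :
    monomial n 1 * C f = monomial n f := by
  rw [(commute_monomial_one (fun k => ?_) n).eq, C_mul_monomial_one]
  rw [C_apply, coeff_monomial, apply_ite Differential.deriv, hf, map_zero, ite_self]

theorem coeff_neg_one_mul_C (a : PDO R) (f : R) : (a * C f).coeff (-1) = a.coeff (-1) * f := by
  rw [coeff_mul, mulCoeff, finsum_eq_single _ ((-1 : ℤ), 0)]
  · simp [C_apply]
  · rintro ⟨i, k⟩ hne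
    by_cases hk : -1 - i + k = 0
    · have hk0 : k ≠ 0 := by
        rintro rfl
        exact hne (by rw [show i = -1 by simp at hk; omega])
      have := Ring.choose_natCast (R := ℤ) (k - 1) k
      rw [Nat.choose_eq_zero_of_lt (by omega), show ((k - 1 : ℕ) : ℤ) = i by omega] at this
      simp [this]
    · simp [C_apply, hk]

theorem isDifferential_of_coeff_neg_one {a : PDO R}
    (ha : ∀ N : ℕ, ((D R : PDO R) ^ N * a).coeff (-1) = 0) : a.IsDifferential := by
  suffices key : ∀ n : ℕ, a.coeff (-1 - n) = 0 by
    intro n hn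
    rw [show n = -1 - ((-1 - n).toNat : ℤ) by omega]
    exact key _
  intro n
  induction n generalizing a with
  | zero => simpa using ha 0
  | succ n ih =>
    have hD : (D R * a).coeff (-1 - n) = 0 :=
      ih fun N => by rw [← mul_assoc, ← pow_succ]; exact ha (N + 1)
    rw [coeff_D_mul, ih ha, map_zero, zero_add] at hD
    rwa [Nat.cast_succ, ← sub_sub]

theorem IsDifferential.of_C_mul {f : R} (hf : IsUnit f) {a : PDO R}
    (ha : (C f * a).IsDifferential) : a.IsDifferential :=
  fun n hn => (hf.mul_right_eq_zero).1 (coeff_C_mul f a n ▸ ha n hn)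

end Ring

section Symbols

variable {R : Type*} [CommRing R]

/-- The operator `∑ fₙ ∂⁻ⁿ` with symbol `f(z⁻¹) = ∑ fₙ z⁻ⁿ`. -/
noncomputable def ofPowerSeries (f : R⟦X⟧) : PDO R :=
  ofSeries fun n => PowerSeries.coeff n f

theorem coeff_ofPowerSeries (f : R⟦X⟧) (n : ℤ) :
    (ofPowerSeries f).coeff n = if n ≤ 0 then PowerSeries.coeff (-n).toNat f else 0 := rfl

theorem coeff_ofPowerSeries_neg (f : R⟦X⟧) (n : ℕ) :
    (ofPowerSeries f).coeff (-n) = PowerSeries.coeff n f := by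
  rw [coeff_ofPowerSeries, if_pos (by omega), neg_neg, Int.toNat_natCast]

theorem orderLE_ofPowerSeries (f : R⟦X⟧) : (ofPowerSeries f).OrderLE 0 :=
  fun _ hn => if_neg hn.not_ge

theorem coeff_ofPowerSeries_C_mul (h : R) (f : R⟦X⟧) (n : ℤ) :
    (ofPowerSeries (PowerSeries.C h * f)).coeff n = h * (ofPowerSeries f).coeff n := by
  simp only [coeff_ofPowerSeries, PowerSeries.coeff_C_mul, mul_ite, mul_zero]

theorem coeff_ofPowerSeries_X_pow_mul (s : ℕ) (f : R⟦X⟧) (n : ℤ) :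
    (ofPowerSeries (PowerSeries.X ^ s * f)).coeff n = (ofPowerSeries f).coeff (n + s) := by
  rw [coeff_ofPowerSeries, coeff_ofPowerSeries, PowerSeries.coeff_X_pow_mul',
    show (-(n + s)).toNat = (-n).toNat - s by omega]
  split_ifs <;> first | rfl | omega

theorem map_coeff_ofPowerSeries {S : Type*} [CommRing S] (φ : R →+* S) (f : R⟦X⟧) (n : ℤ) :
    φ ((ofPowerSeries f).coeff n) = (ofPowerSeries (f.map φ)).coeff n := by
  rw [coeff_ofPowerSeries, coeff_ofPowerSeries, apply_ite φ, map_zero, PowerSeries.coeff_map]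

/-- The action of `∂/∂x + δ z` on the Laurent series `∑ aₙ zⁿ`. For `δ = 1` and the symbol of an
operator `a` this gives the symbol of `∂ ∘ a`. -/
def twist [Differential R] (δ : R) (a : ℤ → R) : ℤ → R :=
  fun n => Differential.deriv (a n) + δ * a (n - 1)

theorem iterate_twist_zero [Differential R] (N : ℕ) (a : ℤ → R) (n : ℤ) :
    (twist 0)^[N] a n = Differential.deriv^[N] (a n) := by
  induction N generalizing a with
  | zero => rfl
  | succ N ih => rw [Function.iterate_succ_apply, ih]; simp [twist]

theorem iterate_twist_const_mul [Differential R] {κ : R} (hκ : Differential.deriv κ = 0) (δ : R)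
    (N : ℕ) (a : ℤ → R) : (twist δ)^[N] (fun n => κ * a n) = fun n => κ * (twist δ)^[N] a n := by
  induction N with
  | zero => rfl
  | succ N ih =>
    rw [Function.iterate_succ_apply', ih, Function.iterate_succ_apply']
    ext n
    simp only [twist, Derivation.leibniz, hκ, smul_eq_mul, mul_zero, add_zero, mul_add,
      mul_left_comm]

end Symbols

section Operators

variable {R : Type*} [CommRing R] [Differential R]

theorem coeff_D_pow_mul (N : ℕ) (a : PDO R) :
    ((D R : PDO R) ^ N * a).coeff = (twist 1)^[N] a.coeff := by
  induction N with
  | zero => simp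
  | succ N ih =>
    ext n
    rw [pow_succ', mul_assoc, coeff_D_mul, ih, Function.iterate_succ_apply', twist, one_mul]

theorem orderLE_ofPowerSeries_sub_C (f : R⟦X⟧) :
    (ofPowerSeries f - C (PowerSeries.constantCoeff f)).OrderLE (-1) := by
  intro n hn
  obtain rfl | hn' := eq_or_lt_of_le (show 0 ≤ n by omega)
  · simp [coeff_sub, coeff_ofPowerSeries, C_apply]
  · rw [coeff_sub, orderLE_ofPowerSeries f n hn', orderLE_C _ n hn', sub_zero]

theorem C_mul_ofPowerSeries (h : R) (f : R⟦X⟧) :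
    C h * ofPowerSeries f = ofPowerSeries (PowerSeries.C h * f) := by
  ext n
  rw [coeff_C_mul, coeff_ofPowerSeries_C_mul]

theorem ofPowerSeries_mul (f : R⟦X⟧) {g : R⟦X⟧}
    (hg : ∀ n, Differential.deriv (PowerSeries.coeff n g) = 0) :
    ofPowerSeries (f * g) = ofPowerSeries f * ofPowerSeries g := by
  refine ext_of_orderLE (A := 0 + 0) (orderLE_ofPowerSeries _)
    ((orderLE_ofPowerSeries f).mul (orderLE_ofPowerSeries g)) fun N => ?_
  rw [coeff_mul_of_le (orderLE_ofPowerSeries f) (orderLE_ofPowerSeries g)]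
  simp only [zero_add, zero_sub, coeff_ofPowerSeries_neg, PowerSeries.coeff_mul]
  refine Finset.sum_congr rfl fun q _ => ?_
  rw [Finset.sum_eq_single (q.2, 0)]
  · simp
  · rintro ⟨n, j⟩ hn hne
    obtain _ | j := j
    · simp_all
    · rw [Function.iterate_succ_apply, hg, iter_zero, mul_zero, smul_zero]
  · simp

/-- The operator `∑ ∂⁻ⁿ ∘ gₙ`, in which the coefficients of the symbol `g(z⁻¹)` stand to the
right of the powers of `∂`. The coefficient of `∂⁻ⁿ` receives no contribution from the summands
beyond the `n`-th. -/
noncomputable def ofPowerSeriesRight (g : R⟦X⟧) : PDO R :=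
  ofSeries fun n => (∑ q ∈ Finset.range (n + 1),
    monomial (-q : ℤ) 1 * C (PowerSeries.coeff q g)).coeff (-n)

theorem orderLE_ofPowerSeriesRight (g : R⟦X⟧) : (ofPowerSeriesRight g).OrderLE 0 :=
  fun _ hn => if_neg hn.not_ge

theorem orderLE_ofPowerSeriesRight_sub_sum (g : R⟦X⟧) (K : ℕ) :
    (ofPowerSeriesRight g - ∑ q ∈ Finset.range K,
      monomial (-q : ℤ) 1 * C (PowerSeries.coeff q g)).OrderLE (-K) := by
  have hq : ∀ q : ℕ, (monomial (-q : ℤ) 1 * C (PowerSeries.coeff q g)).OrderLE (-q) := fun q => by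
    simpa using (orderLE_monomial (-q : ℤ) (1 : R)).mul (orderLE_C (PowerSeries.coeff q g))
  intro n hn
  obtain hn0 | hn0 := lt_or_ge 0 n
  · rw [coeff_sub, orderLE_ofPowerSeriesRight g n hn0, coeff_sum, zero_sub, neg_eq_zero]
    exact Finset.sum_eq_zero fun q _ => hq q n (by omega)
  · obtain ⟨n, rfl⟩ := Int.exists_eq_neg_ofNat hn0
    rw [coeff_sub, sub_eq_zero, ofPowerSeriesRight]
    change (if _ then _ else _) = _
    rw [if_pos hn0, neg_neg, Int.toNat_natCast, coeff_sum, coeff_sum]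
    refine Finset.sum_subset (Finset.range_mono (by omega)) fun q _ hq' => ?_
    exact hq q _ (by rw [Finset.mem_range] at hq'; omega)

theorem orderLE_ofPowerSeriesRight_sub_C (g : R⟦X⟧) :
    (ofPowerSeriesRight g - C (PowerSeries.constantCoeff g)).OrderLE (-1) := by
  have h := orderLE_ofPowerSeriesRight_sub_sum g 1
  rwa [Finset.sum_range_one, Nat.cast_zero, neg_zero, ← C_apply, map_one, one_mul,
    PowerSeries.coeff_zero_eq_constantCoeff_apply] at h

theorem ofPowerSeriesRight_eq_ofPowerSeries {g : R⟦X⟧}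
    (hg : ∀ n, Differential.deriv (PowerSeries.coeff n g) = 0) :
    ofPowerSeriesRight g = ofPowerSeries g := by
  refine ext_of_orderLE (orderLE_ofPowerSeriesRight g) (orderLE_ofPowerSeries g) fun n => ?_
  rw [zero_sub, coeff_ofPowerSeries_neg]
  change (if _ then _ else _) = _
  rw [if_pos (by omega), neg_neg, Int.toNat_natCast, coeff_sum, Finset.sum_eq_single_of_mem n]
  · rw [monomial_one_mul_C (hg n), coeff_monomial, if_pos rfl]
  · exact Finset.self_mem_range_succ n
  · intro q _ hqn
    rw [monomial_one_mul_C (hg q), coeff_monomial, if_neg (by omega)]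

theorem coeff_neg_one_mul_ofPowerSeriesRight {a : PDO R} {M : ℤ} (ha : a.OrderLE M) (g : R⟦X⟧)
    {K : ℕ} (hK : M + 1 < K) :
    (a * ofPowerSeriesRight g).coeff (-1)
      = ∑ q ∈ Finset.range K, a.coeff (-1 + q) * PowerSeries.coeff q g := by
  have h := (ha.mul (orderLE_ofPowerSeriesRight_sub_sum g K)) (-1) (by omega)
  rw [mul_sub, coeff_sub, sub_eq_zero] at h
  rw [h, Finset.mul_sum, coeff_sum]
  refine Finset.sum_congr rfl fun q _ => ?_
  rw [← mul_assoc, coeff_neg_one_mul_C, coeff_mul_monomial_one, sub_neg_eq_add]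

theorem map_coeff_neg_one_mul_ofPowerSeriesRight {S : Type*} [CommRing S] (ev : R →+* S)
    (a : PDO R) {g g' : R⟦X⟧} (hg : PowerSeries.map ev g = PowerSeries.map ev g') :
    ev ((a * ofPowerSeriesRight g).coeff (-1)) = ev ((a * ofPowerSeriesRight g').coeff (-1)) := by
  obtain ⟨M, hM⟩ := a.exists_orderLE
  have hK : M + 1 < ((M + 2).toNat : ℤ) := by omega
  rw [coeff_neg_one_mul_ofPowerSeriesRight hM g hK, coeff_neg_one_mul_ofPowerSeriesRight hM g' hK,
    map_sum, map_sum]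
  refine Finset.sum_congr rfl fun q _ => ?_
  rw [map_mul, map_mul, ← PowerSeries.coeff_map, hg, PowerSeries.coeff_map]

/-- The power series `∑ zⁿ ∑_{i + j = n} fᵢ ∘ ∂⁻¹ ∘ gⱼ`. -/
noncomputable def invSandwich (f g : R⟦X⟧) : (PDO R)⟦X⟧ :=
  f.map C * PowerSeries.C (monomial (-1) 1) * g.map C

theorem coeff_invSandwich (f g : R⟦X⟧) (n : ℕ) :
    PowerSeries.coeff n (invSandwich f g) = ∑ q ∈ Finset.HasAntidiagonal.antidiagonal n,
      C (PowerSeries.coeff q.1 f) * monomial (-1) 1 * C (PowerSeries.coeff q.2 g) := by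
  rw [invSandwich, PowerSeries.coeff_mul]
  simp only [PowerSeries.coeff_mul_C, PowerSeries.coeff_map]

theorem C_mul_coeff_invSandwich (h : R) (f g : R⟦X⟧) (n : ℕ) :
    C h * PowerSeries.coeff n (invSandwich f g)
      = PowerSeries.coeff n (invSandwich (PowerSeries.C h * f) g) := by
  simp only [coeff_invSandwich, Finset.mul_sum, PowerSeries.coeff_C_mul, map_mul, mul_assoc]

theorem coeff_neg_one_D_pow_mul_C_mul_monomial (N : ℕ) (f : R) :
    ((D R : PDO R) ^ N * (C f * monomial (-1) 1)).coeff (-1) = Differential.deriv^[N] f := by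
  induction N generalizing f with
  | zero => simp [C_mul_monomial_one]
  | succ N ih =>
    have hD : (D R : PDO R) * monomial (-1) 1 = 1 := (D R).mul_inv
    rw [pow_succ, mul_assoc, ← mul_assoc (D R : PDO R), D_mul_C, add_mul, mul_assoc (C f), hD,
      mul_one, mul_add, coeff_add, ih,
      (isDifferential_D_pow N).mul (isDifferential_C f) (-1) (by omega), add_zero,
      Function.iterate_succ_apply]

theorem coeff_neg_one_D_pow_mul_coeff_invSandwich (N : ℕ) (f g : R⟦X⟧) (n : ℕ) :
    ((D R : PDO R) ^ N * PowerSeries.coeff n (invSandwich f g)).coeff (-1)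
      = ∑ q ∈ Finset.HasAntidiagonal.antidiagonal n,
        Differential.deriv^[N] (PowerSeries.coeff q.1 f) * PowerSeries.coeff q.2 g := by
  simp only [coeff_invSandwich, Finset.mul_sum, coeff_sum, ← mul_assoc, coeff_neg_one_mul_C]
  simp only [mul_assoc, coeff_neg_one_D_pow_mul_C_mul_monomial]

end Operators

section ConstantCoefficients

variable {R S : Type*} [CommRing R] [Differential R] [CommRing S] (ev : R →+* S) {g g' : R⟦X⟧}

theorem map_coeff_neg_one_D_pow_mul_ofPowerSeries_mul
    (hg : PowerSeries.map ev g = PowerSeries.map ev g')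
    (hg' : ∀ n, Differential.deriv (PowerSeries.coeff n g') = 0) (N : ℕ) (f : R⟦X⟧) (s : ℤ) :
    ev (((D R : PDO R) ^ N * (ofPowerSeries f * monomial s 1 * ofPowerSeriesRight g)).coeff (-1))
      = ev ((twist 1)^[N] (ofPowerSeries (f * g')).coeff (-1 - s)) := by
  have hcomm : Commute (monomial s 1) (ofPowerSeries g') :=
    commute_monomial_one (fun n => by
      rw [coeff_ofPowerSeries, apply_ite Differential.deriv, hg', map_zero, ite_self]) s
  rw [← mul_assoc, map_coeff_neg_one_mul_ofPowerSeriesRight ev _ hg,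
    ofPowerSeriesRight_eq_ofPowerSeries hg', ← coeff_D_pow_mul, mul_assoc, mul_assoc, hcomm.eq,
    ← mul_assoc (ofPowerSeries f), ← ofPowerSeries_mul f hg', ← mul_assoc, coeff_mul_monomial_one]

theorem map_coeff_neg_one_D_pow_mul_coeff_invSandwich
    (hg : PowerSeries.map ev g = PowerSeries.map ev g')
    (hg' : ∀ n, Differential.deriv (PowerSeries.coeff n g') = 0) (N : ℕ) (f : R⟦X⟧) (n : ℕ) :
    ev (((D R : PDO R) ^ N * PowerSeries.coeff n (invSandwich f g)).coeff (-1))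
      = ev ((twist 0)^[N] (ofPowerSeries (f * g')).coeff (-n)) := by
  have hmul : ∀ (h c : R), Differential.deriv c = 0 →
      Differential.deriv^[N] (h * c) = Differential.deriv^[N] h * c := by
    intro h c hc
    induction N generalizing h with
    | zero => rfl
    | succ N ih => simp only [Function.iterate_succ_apply, Derivation.leibniz, hc, ih,
        smul_eq_mul, mul_zero, zero_add, mul_comm c]
  rw [coeff_neg_one_D_pow_mul_coeff_invSandwich, iterate_twist_zero, coeff_ofPowerSeries_neg,
    PowerSeries.coeff_mul, iter_sum, map_sum, map_sum]
  refine Finset.sum_congr rfl fun q _ => ?_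
  rw [hmul _ _ (hg' _), map_mul, map_mul, ← PowerSeries.coeff_map, hg, PowerSeries.coeff_map]

end ConstantCoefficients

section Exponential

variable {R : Type*} [CommRing R] [Algebra ℚ R]

/-- The formal exponential `e^{xz}`, a power series in `z`. -/
noncomputable def expSeries (x : R) : R⟦X⟧ :=
  PowerSeries.rescale x (PowerSeries.exp R)

theorem expSeries_mul_expSeries_neg (x : R) : expSeries x * expSeries (-x) = 1 := by
  rw [expSeries, expSeries, PowerSeries.exp_mul_exp_eq_exp_add, add_neg_cancel,
    PowerSeries.rescale_zero_apply, PowerSeries.constantCoeff_exp, map_one]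

theorem coeff_expSeries (x : R) (n : ℕ) :
    PowerSeries.coeff n (expSeries x) = algebraMap ℚ R (1 / n.factorial) * x ^ n := by
  rw [expSeries, PowerSeries.coeff_rescale, PowerSeries.coeff_exp, mul_comm]

theorem coeff_expSeries_neg (x : R) (n : ℕ) :
    PowerSeries.coeff n (expSeries (-x)) = (-1) ^ n * PowerSeries.coeff n (expSeries x) := by
  rw [coeff_expSeries, coeff_expSeries, neg_pow x, mul_left_comm]

end Exponential

theorem constantCoeff_rescale {R : Type*} [CommSemiring R] (a : R) (f : R⟦X⟧) :
    PowerSeries.constantCoeff (PowerSeries.rescale a f) = PowerSeries.constantCoeff f := by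
  rw [← PowerSeries.coeff_zero_eq_constantCoeff_apply, PowerSeries.coeff_rescale, pow_zero,
    one_mul, PowerSeries.coeff_zero_eq_constantCoeff_apply]

theorem coeff_succ_mul_of_constantCoeff_eq_zero {R : Type*} [CommRing R] (f : R⟦X⟧) {g : R⟦X⟧}
    (hg : PowerSeries.constantCoeff g = 0) (n : ℕ) :
    PowerSeries.coeff (n + 1) (f * g) = ∑ i ∈ Finset.range (n + 1),
      PowerSeries.coeff i f * PowerSeries.coeff (n - i + 1) g := by
  rw [PowerSeries.coeff_mul, Finset.Nat.sum_antidiagonal_eq_sum_range_succ_mk,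
    Finset.sum_range_succ, Nat.sub_self, PowerSeries.coeff_zero_eq_constantCoeff_apply, hg,
    mul_zero, add_zero]
  refine Finset.sum_congr rfl fun i hi => ?_
  rw [Nat.sub_add_comm (Nat.lt_succ_iff.1 (Finset.mem_range.1 hi))]

section Truncation

variable {R : Type*} [CommRing R] [Differential R]

theorem map_X_mul_mul_map_X_mul (f g : R⟦X⟧) (J : (PDO R)⟦X⟧) :
    (PowerSeries.X * f).map C * J * (PowerSeries.X * g).map C
      = PowerSeries.X * (PowerSeries.X * (f.map C * J * g.map C)) := by
  rw [map_mul, map_mul, PowerSeries.map_X, mul_assoc PowerSeries.X, mul_assoc PowerSeries.X,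
    ← mul_assoc _ PowerSeries.X, (PowerSeries.commute_X (f.map C * J)).eq, mul_assoc PowerSeries.X]

theorem coeff_invUnitsSub_D (n : ℕ) :
    PowerSeries.coeff n (PowerSeries.invUnitsSub (D R)) = monomial (-(n + 1)) 1 := by
  rw [PowerSeries.coeff_invUnitsSub, one_divp, ← coe_D_zpow]
  congr 1

theorem coeff_map_mul_invUnitsSub_mul_map (f g : R⟦X⟧) (n : ℕ) :
    PowerSeries.coeff n (f.map C * PowerSeries.invUnitsSub (D R) * g.map C)
      = ∑ i ∈ Finset.range (n + 1), ∑ j ∈ Finset.range (n + 1 - i),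
        C (PowerSeries.coeff i f) * monomial (i + j - (n + 1)) 1 * C (PowerSeries.coeff j g) := by
  rw [mul_assoc, PowerSeries.coeff_mul, Finset.Nat.sum_antidiagonal_eq_sum_range_succ_mk]
  refine Finset.sum_congr rfl fun i hi => ?_
  rw [Finset.mem_range] at hi
  rw [PowerSeries.coeff_mul, ← Finset.Nat.sum_antidiagonal_swap,
    Finset.Nat.sum_antidiagonal_eq_sum_range_succ_mk, Finset.mul_sum,
    show n + 1 - i = (n - i).succ by omega]
  refine Finset.sum_congr rfl fun j hj => ?_
  rw [Finset.mem_range] at hj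
  rw [Prod.swap_prod_mk, coeff_invUnitsSub_D, PowerSeries.coeff_map, PowerSeries.coeff_map,
    ← mul_assoc, show -(((n - i - j : ℕ) : ℤ) + 1) = i + j - (n + 1) by omega]

/-- The operator `∑_{j < s} f_{j+1} ∂ʲ`; it is `W̃_{ab}`, `a ≤ r₁ < b`, for `s = p_b` and
`f(z) = e^{-xz} Q⁺_{ab}(z⁻¹)`. -/
noncomputable def leftTruncation (s : ℕ) (f : R⟦X⟧) : PDO R :=
  ∑ j ∈ Finset.range s, monomial j (PowerSeries.coeff (j + 1) f)

/-- The operator `∑_{j < s} ∂ʲ ∘ f_{j+1}`; it is `W̃_{ab}`, `b ≤ r₁ < a`, for `s = p_a` and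
`f(z) = e^{xz} Q⁻_{ba}(-z⁻¹)`. -/
noncomputable def rightTruncation (s : ℕ) (f : R⟦X⟧) : PDO R :=
  ∑ j ∈ Finset.range s, (D R : PDO R) ^ j * C (PowerSeries.coeff (j + 1) f)

theorem isDifferential_leftTruncation (s : ℕ) (f : R⟦X⟧) : (leftTruncation s f).IsDifferential :=
  (differentialSubring R).sum_mem fun _ _ => isDifferential_monomial (by omega) _

theorem isDifferential_rightTruncation (s : ℕ) (f : R⟦X⟧) :
    (rightTruncation s f).IsDifferential :=
  (differentialSubring R).sum_mem fun j _ => (isDifferential_D_pow j).mul (isDifferential_C _)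

theorem orderLE_leftTruncation (s : ℕ) (f : R⟦X⟧) : (leftTruncation s f).OrderLE (s - 1) :=
  (filtration R _).sum_mem fun j hj => (orderLE_monomial _ _).mono (by
    rw [Finset.mem_range] at hj
    omega)

theorem orderLE_rightTruncation (s : ℕ) (f : R⟦X⟧) : (rightTruncation s f).OrderLE (s - 1) :=
  (filtration R _).sum_mem fun j hj => by
    rw [Finset.mem_range] at hj
    rw [coe_D_pow]
    exact ((orderLE_monomial _ _).mul (orderLE_C _)).mono (by omega)

theorem leftTruncation_mul_monomial_mul_rightTruncation (s : ℕ) (f g : R⟦X⟧) :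
    leftTruncation s f * monomial (-s) 1 * rightTruncation s g
      = ∑ i ∈ Finset.range s, ∑ j ∈ Finset.range s,
        C (PowerSeries.coeff (i + 1) f) * monomial (i + j - s) 1
          * C (PowerSeries.coeff (j + 1) g) := by
  simp only [leftTruncation, rightTruncation, Finset.sum_mul, Finset.mul_sum]
  rw [Finset.sum_comm]
  refine Finset.sum_congr rfl fun i _ => Finset.sum_congr rfl fun j _ => ?_
  rw [coe_D_pow, ← mul_assoc, monomial_mul_monomial_one, monomial_mul_monomial_one,
    C_mul_monomial_one]
  congr 2
  ring

end Truncation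

section ExponentialSandwich

variable {R : Type*} [CommRing R] [Differential R] [Algebra ℚ R] {x : R}

theorem leftTruncation_expSeries_mul (s : ℕ) {f : R⟦X⟧} (hf : PowerSeries.constantCoeff f = 0) :
    leftTruncation s (expSeries x * f) = ∑ j ∈ Finset.range s, ∑ i ∈ Finset.range (j + 1),
      monomial j (PowerSeries.coeff i (expSeries x) * PowerSeries.coeff (j - i + 1) f) := by
  simp only [leftTruncation, coeff_succ_mul_of_constantCoeff_eq_zero _ hf, monomial_sum]

theorem rightTruncation_expSeries_mul_rescale_neg_one (s : ℕ) {g : R⟦X⟧}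
    (hg : PowerSeries.constantCoeff g = 0) :
    rightTruncation s (expSeries x * PowerSeries.rescale (-1) g)
      = -∑ j ∈ Finset.range s, ∑ i ∈ Finset.range (j + 1), (-(D R : PDO R)) ^ j *
        C (PowerSeries.coeff (j - i + 1) g * PowerSeries.coeff i (expSeries (-x))) := by
  have hg' : PowerSeries.constantCoeff (PowerSeries.rescale (-1) g) = 0 := by
    rw [constantCoeff_rescale, hg]
  have hsign : ∀ i d, (-1 : R) ^ (i + d) * (-1) ^ i = -(-1) ^ (d + 1) := fun i d => by
    rw [pow_add, mul_right_comm, ← mul_pow, neg_one_mul, neg_neg, one_pow, one_mul, pow_succ,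
      mul_neg_one, neg_neg]
  simp only [rightTruncation, coeff_succ_mul_of_constantCoeff_eq_zero _ hg', map_sum,
    Finset.mul_sum, ← Finset.sum_neg_distrib]
  refine Finset.sum_congr rfl fun j _ => Finset.sum_congr rfl fun i hi => ?_
  obtain ⟨d, rfl⟩ := Nat.exists_eq_add_of_le (Nat.lt_succ_iff.1 (Finset.mem_range.1 hi))
  rw [Nat.add_sub_cancel_left, PowerSeries.coeff_rescale, coeff_expSeries_neg,
    neg_pow' (D R : PDO R), show (-1 : PDO R) ^ (i + d) = C ((-1) ^ (i + d)) by simp, mul_assoc,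
    ← map_mul, ← mul_neg, ← map_neg]
  congr 2
  linear_combination (PowerSeries.coeff i (expSeries x) * PowerSeries.coeff (d + 1) g) * hsign i d

theorem deriv_coeff_expSeries_succ (hx : Differential.deriv x = 1) (n : ℕ) :
    Differential.deriv (PowerSeries.coeff (n + 1) (expSeries x))
      = PowerSeries.coeff n (expSeries x) := by
  have hfact : (1 / (n + 1).factorial : ℚ) * (n + 1) = 1 / n.factorial := by
    rw [Nat.factorial_succ]
    push_cast
    field_simp
  rw [coeff_expSeries, coeff_expSeries, ← Algebra.smul_def, map_rat_smul,
    Derivation.leibniz_pow, hx, ← hfact, Algebra.smul_def, map_mul]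
  simp
  ring

theorem C_D_mul_map_expSeries (hx : Differential.deriv x = 1) :
    PowerSeries.C (D R : PDO R) * (expSeries x).map C
      = (expSeries x).map C * PowerSeries.C (D R : PDO R)
        + PowerSeries.X * (expSeries x).map C := by
  ext1 n
  rw [PowerSeries.coeff_C_mul, map_add, PowerSeries.coeff_mul_C, PowerSeries.coeff_map, D_mul_C,
    add_comm]
  obtain _ | n := n
  · simp [coeff_expSeries]
  · rw [PowerSeries.coeff_succ_X_mul, PowerSeries.coeff_map, deriv_coeff_expSeries_succ hx]

/-- In the usual notation, `e^{xz} ∘ ∂⁻¹ ∘ e^{-xz} = (∂ - z)⁻¹`. -/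
theorem invSandwich_expSeries (hx : Differential.deriv x = 1) :
    invSandwich (expSeries x) (expSeries (-x)) = PowerSeries.invUnitsSub (D R) := by
  have hD : (D R : PDO R) * monomial (-1) 1 = 1 := (D R).mul_inv
  refine (left_inv_eq_right_inv (PowerSeries.invUnitsSub_mul_sub (D R)) ?_).symm
  rw [sub_mul, invSandwich, ← mul_assoc, ← mul_assoc, C_D_mul_map_expSeries hx, add_mul, add_mul,
    mul_assoc _ (PowerSeries.C _) (PowerSeries.C _), ← map_mul, hD, map_one, mul_one, ← map_mul,
    expSeries_mul_expSeries_neg, map_one, mul_assoc PowerSeries.X, mul_assoc PowerSeries.X,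
    add_sub_cancel_right]

theorem invSandwich_expSeries_mul (hx : Differential.deriv x = 1) (f g : R⟦X⟧) :
    invSandwich (expSeries x * f) (expSeries (-x) * g)
      = f.map C * PowerSeries.invUnitsSub (D R) * g.map C := by
  rw [← invSandwich_expSeries hx, invSandwich, invSandwich, mul_comm (expSeries x), map_mul,
    map_mul]
  simp only [mul_assoc]

theorem isDifferential_leftTruncation_mul_sub_coeff_invSandwich (hx : Differential.deriv x = 1)
    {f g : R⟦X⟧} (hf : PowerSeries.constantCoeff f = 0) (hg : PowerSeries.constantCoeff g = 0)
    (s : ℕ) :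
    (leftTruncation s (expSeries (-x) * f) * monomial (-s) 1 * rightTruncation s (expSeries x * g)
      - PowerSeries.coeff (s + 1) (invSandwich f g)).IsDifferential := by
  obtain ⟨u, hu⟩ : PowerSeries.X ∣ expSeries (-x) * f :=
    PowerSeries.X_dvd_iff.2 (by rw [map_mul, hf, mul_zero])
  obtain ⟨v, hv⟩ : PowerSeries.X ∣ expSeries x * g :=
    PowerSeries.X_dvd_iff.2 (by rw [map_mul, hg, mul_zero])
  have hf' : expSeries x * (PowerSeries.X * u) = f := by
    rw [← hu, ← mul_assoc, expSeries_mul_expSeries_neg, one_mul]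
  have hg' : expSeries (-x) * (PowerSeries.X * v) = g := by
    rw [← hv, ← mul_assoc, mul_comm (expSeries _), expSeries_mul_expSeries_neg, one_mul]
  have hfg : invSandwich f g = PowerSeries.X * (PowerSeries.X *
      (u.map C * PowerSeries.invUnitsSub (D R) * v.map C)) := by
    rw [← map_X_mul_mul_map_X_mul, ← invSandwich_expSeries_mul hx, hf', hg']
  rw [hu, hv, hfg, leftTruncation_mul_monomial_mul_rightTruncation, PowerSeries.coeff_succ_X_mul]
  simp only [PowerSeries.coeff_succ_X_mul]
  obtain _ | n := s
  · rw [PowerSeries.coeff_zero_X_mul, Finset.sum_range_zero, sub_zero]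
    exact zero_mem (differentialSubring R)
  · rw [PowerSeries.coeff_succ_X_mul, coeff_map_mul_invUnitsSub_mul_map, ← Finset.sum_sub_distrib]
    refine sum_mem (S := differentialSubring R) fun i _ => ?_
    rw [← Finset.sum_sdiff (Finset.range_mono (Nat.sub_le (n + 1) i)), Nat.cast_succ,
      add_sub_cancel_right]
    refine sum_mem (S := differentialSubring R) fun j hj => ?_
    rw [Finset.mem_sdiff, Finset.mem_range, Finset.mem_range] at hj
    exact ((isDifferential_C _).mul (isDifferential_monomial (by omega) 1)).mul (isDifferential_C _)

end ExponentialSandwich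

section Matrix

variable {R : Type*} [CommRing R] [Differential R] {l n o : Type*}

theorem one_mem_matrix_filtration [DecidableEq n] :
    (1 : Matrix n n (PDO R)) ∈ (filtration R 0).matrix := by
  intro i j
  rw [Matrix.one_apply]
  split_ifs
  exacts [orderLE_monomial 0 1, zero_mem (filtration R 0)]

theorem mul_mem_matrix_filtration [Fintype n] {A : Matrix l n (PDO R)} {B : Matrix n o (PDO R)}
    {M N : ℤ} (hA : A ∈ (filtration R M).matrix) (hB : B ∈ (filtration R N).matrix) :
    A * B ∈ (filtration R (M + N)).matrix := by
  intro i j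
  rw [Matrix.mul_apply]
  exact (filtration R (M + N)).sum_mem fun c _ => (hA i c).mul (hB c j)

variable [Fintype n] [DecidableEq n] {A B : Matrix n n (PDO R)}

theorem mul_mul_sub_mem_matrix_filtration {Δ : Matrix n n (PDO R)} {N : ℤ}
    (hA : A - 1 ∈ (filtration R (-1)).matrix) (hΔ : Δ ∈ (filtration R N).matrix)
    (hB : B - 1 ∈ (filtration R (-1)).matrix) :
    A * Δ * B - Δ ∈ (filtration R (N - 1)).matrix := by
  have hAΔ : (A - 1) * Δ ∈ (filtration R (N - 1)).matrix := by
    simpa only [neg_add_eq_sub] using mul_mem_matrix_filtration hA hΔ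
  have hΔB : Δ * (B - 1) ∈ (filtration R (N - 1)).matrix := mul_mem_matrix_filtration hΔ hB
  have hAΔB : (A - 1) * Δ * (B - 1) ∈ (filtration R (N - 1)).matrix := fun i j =>
    (mul_mem_matrix_filtration hAΔ hB i j).mono (by omega)
  rw [show A * Δ * B - Δ = (A - 1) * Δ * (B - 1) + (A - 1) * Δ + Δ * (B - 1) by noncomm_ring]
  exact add_mem (add_mem hAΔB hAΔ) hΔB

theorem mul_sub_one_mem_matrix_filtration (hA : A - 1 ∈ (filtration R (-1)).matrix)
    (hB : B - 1 ∈ (filtration R (-1)).matrix) : A * B - 1 ∈ (filtration R (-1)).matrix := by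
  simpa only [mul_one, zero_sub] using
    mul_mul_sub_mem_matrix_filtration hA one_mem_matrix_filtration hB

theorem mul_eq_one_of_isDifferential (hA : A - 1 ∈ (filtration R (-1)).matrix)
    (hB : B - 1 ∈ (filtration R (-1)).matrix) (hAB : A * B ∈ (differentialSubring R).matrix) :
    A * B = 1 := by
  have hAB' : A * B - 1 ∈ (differentialSubring R).matrix :=
    sub_mem hAB (one_mem (differentialSubring R).matrix)
  rw [← sub_eq_zero]
  ext1 i j
  exact (hAB' i j).eq_zero_of_orderLE (mul_sub_one_mem_matrix_filtration hA hB i j)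

theorem mul_eq_one_symm (hA : A - 1 ∈ (filtration R (-1)).matrix)
    (hB : B - 1 ∈ (filtration R (-1)).matrix) (h : A * B = 1) : B * A = 1 := by
  have hE : B * A - 1 = -((A - 1) * (B * A - 1)) := by
    have : A * (B * A - 1) = 0 := by rw [mul_sub, ← mul_assoc, h, one_mul, mul_one, sub_self]
    rw [sub_mul, this, one_mul, zero_sub, neg_neg]
  have hE_mem : ∀ N : ℕ, B * A - 1 ∈ (filtration R (-N)).matrix := by
    intro N
    induction N with
    | zero => exact fun i j => (mul_sub_one_mem_matrix_filtration hB hA i j).mono (by omega)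
    | succ N ih =>
      rw [hE, show (-((N + 1 : ℕ) : ℤ)) = -1 + -N by omega]
      exact neg_mem (mul_mem_matrix_filtration hA ih)
  rw [← sub_eq_zero]
  ext1 i j
  exact eq_zero_of_forall_orderLE fun N => hE_mem N i j

end Matrix

end PDO

theorem sum_mul_single_mul_pow {S n : Type*} [Semiring S] [Fintype n] [DecidableEq n]
    {A B : Matrix n n S} (h : B * A = 1) (x : S) {k : ℕ} (hk : k ≠ 0) :
    ∑ a, (A * Matrix.single a a x * B) ^ k = A * Matrix.diagonal (fun _ => x ^ k) * B := by
  have hpow : ∀ a, (A * Matrix.single a a x * B) ^ k = A * Matrix.single a a (x ^ k) * B := by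
    intro a
    obtain ⟨k, rfl⟩ := Nat.exists_eq_succ_of_ne_zero hk
    clear hk
    induction k with
    | zero => simp
    | succ k ih =>
      calc (A * Matrix.single a a x * B) ^ (k + 1 + 1)
          = A * Matrix.single a a (x ^ (k + 1)) * (B * A) * Matrix.single a a x * B := by
            rw [pow_succ, ih]
            simp only [mul_assoc]
        _ = A * Matrix.single a a (x ^ (k + 1 + 1)) * B := by
            rw [h, mul_one, mul_assoc A, Matrix.single_mul_single_same, pow_succ x (k + 1)]
  rw [Finset.sum_congr rfl fun a _ => hpow a, ← Finset.sum_mul, ← Finset.mul_sum,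
    Matrix.sum_single_eq_diagonal]

namespace smoothFun

variable {𝕜 : Type*} [RCLike 𝕜] [NormedAlgebra 𝕜 ℂ] {U : TopologicalSpace.Opens 𝕜}

/-- Evaluation at a point of `U`. -/
def eval (u : U) : smoothFun U →ₐ[ℂ] ℂ :=
  (Pi.evalAlgHom ℂ (fun _ : U => ℂ) u).comp (smoothFun U).val

theorem eval_deriv_of_hasDerivAt {f : smoothFun U} {g : 𝕜 → ℂ} {g' : ℂ} {u : U}
    (hfg : ∀ v : U, eval v f = g v) (hg : HasDerivAt g g' (u : 𝕜)) :
    eval u (Differential.deriv f) = g' :=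
  (zeroExt_eventuallyEq f.1 g hfg u).deriv_eq.trans hg.deriv

theorem ext_eval {f g : smoothFun U} (h : ∀ u, eval u f = eval u g) : f = g :=
  Subtype.ext (funext h)

theorem map_eval_map_algebraMap (u : U) (f : PowerSeries ℂ) :
    (f.map (algebraMap ℂ (smoothFun U))).map (eval u : smoothFun U →+* ℂ) = f := by
  ext n
  rw [PowerSeries.coeff_map, PowerSeries.coeff_map]
  exact (eval u).commutes _

theorem deriv_algebraMap (c : ℂ) : Differential.deriv (algebraMap ℂ (smoothFun U) c) = 0 :=
  ext_eval fun _ => (eval_deriv_of_hasDerivAt (g := fun _ => c) (fun v => (eval v).commutes c)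
    (hasDerivAt_const _ c)).trans (map_zero _).symm

theorem deriv_X : Differential.deriv (X U) = 1 :=
  ext_eval fun _ => (eval_deriv_of_hasDerivAt (fun _ => rfl)
    (algebraMapCLM 𝕜 ℂ).hasDerivAt).trans (map_one (algebraMap 𝕜 ℂ))

end smoothFun

section Times

variable {𝕜 : Type*} [RCLike 𝕜] {r : ℕ}

theorem Times.shift_single (t : Times 𝕜 r) (S : Finset (Fin r × ℕ+)) (i : S) (h : 𝕜) :
    t.shift S (Pi.single i h) = t + Pi.single (i : Fin r × ℕ+) h := by
  funext q
  by_cases hq : q = i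
  · subst hq
    simp [Times.shift]
  · by_cases hS : q ∈ S <;> simp [Times.shift, hq, hS, Subtype.ext_iff]

variable [NormedAlgebra 𝕜 ℂ] {D : Set (Times 𝕜 r)} {f : Times 𝕜 r → ℂ}

theorem SmoothInTimes.timeDeriv_eq_fderiv (hf : SmoothInTimes D f) {t : Times 𝕜 r} (ht : t ∈ D)
    (S : Finset (Fin r × ℕ+)) (i : S) :
    _root_.timeDeriv (i : Fin r × ℕ+) f t
      = fderiv 𝕜 (fun s : S → 𝕜 => f (t.shift S s)) 0 (Pi.single i 1) := by
  have hF := ((hf t ht S).differentiableAt (by simp)).hasFDerivAt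
  rw [← Pi.single_zero i] at hF
  have hderiv := (hF.comp_hasDerivAt (0 : 𝕜) (hasDerivAt_single i 0)).deriv
  simp only [Function.comp_def, Times.shift_single, Pi.single_zero] at hderiv
  exact hderiv

namespace TauFunction

theorem smoothInTimes_twistedDeriv {G : ℤ → Times 𝕜 r → ℂ} (hG : ∀ n, SmoothInTimes D (G n))
    (a : Fin r) (i : Fin r × ℕ+) (n : ℤ) : SmoothInTimes D (twistedDeriv a i G n) := by
  intro t ht S
  refine ((hG n).timeDeriv i t ht S).add ?_
  split_ifs
  exacts [hG _ t ht S, contDiffAt_const]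

variable [NeZero r]

theorem hasDerivAt_comp_reducedTimes (hf : SmoothInTimes D f) (p : Fin r → ℕ) (t : Times 𝕜 r)
    {x : 𝕜} (hx : reducedTimes p t x ∈ D) :
    HasDerivAt (fun y => f (reducedTimes p t y))
      (∑ i : shiftedTimes p, timeDeriv i.1 f (reducedTimes p t x)) x := by
  have hF := ((hf _ hx (shiftedTimes p)).differentiableAt (by simp)).hasFDerivAt
  rw [show (0 : shiftedTimes p → 𝕜) = fun _ => x - x from funext fun _ => (sub_self x).symm] at hF
  have hshift : HasDerivAt (fun (y : 𝕜) (_ : shiftedTimes p) => y - x) (∑ i, Pi.single i 1) x := by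
    rw [Finset.univ_sum_single (fun _ : shiftedTimes p => (1 : 𝕜))]
    exact hasDerivAt_pi.2 fun _ => (hasDerivAt_id x).sub_const x
  have hcomp := hF.comp_hasDerivAt x hshift
  simp only [Function.comp_def, ← reducedTimes_eq_shift, map_sum, sub_self] at hcomp
  simp only [hf.timeDeriv_eq_fderiv hx]
  exact hcomp

theorem sum_shiftedTimes_ite (p : Fin r → ℕ) (c : Fin r) (y : ℂ) :
    ∑ i : shiftedTimes p, (if i.1.1 = c then y else 0) = if p c = p 0 then y else 0 := by
  rw [Finset.sum_coe_sort (shiftedTimes p) fun i => if i.1 = c then y else 0, shiftedTimes,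
    Finset.sum_product]
  simp [Finset.sum_ite_eq']

variable {U : TopologicalSpace.Opens 𝕜} {p : Fin r → ℕ} {t : Times 𝕜 r}

theorem eval_iterate_twist (hU : ∀ u : U, reducedTimes p t u ∈ D) (c : Fin r)
    {a : ℤ → smoothFun U} {G : ℤ → Times 𝕜 r → ℂ} (hG : ∀ n, SmoothInTimes D (G n)) {s : ℤ}
    (ha : ∀ n u, smoothFun.eval u (a n) = G (n + s) (reducedTimes p t u)) (N : ℕ) (n : ℤ) (u : U) :
    smoothFun.eval u ((PDO.twist (if p c = p 0 then 1 else 0))^[N] a n)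
      = ∑ w : Fin N → shiftedTimes p,
        (List.ofFn fun i => (w i).1).foldr (twistedDeriv c) G (n + s) (reducedTimes p t u) := by
  have hsmooth : ∀ (l : List (Fin r × ℕ+)) (n : ℤ),
      SmoothInTimes D (l.foldr (twistedDeriv c) G n) := by
    intro l
    induction l with
    | nil => exact hG
    | cons i l ih => exact smoothInTimes_twistedDeriv ih c i
  induction N generalizing n u with
  | zero => simpa using ha n u
  | succ N ih =>
    have hderiv := smoothFun.eval_deriv_of_hasDerivAt (ih n) (HasDerivAt.fun_sum fun w _ =>
      hasDerivAt_comp_reducedTimes (hsmooth _ (n + s)) p t (hU u))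
    rw [Function.iterate_succ_apply', PDO.twist, map_add, map_mul, ih, hderiv, Finset.mul_sum,
      ← Finset.sum_add_distrib, ← (Fin.consEquiv fun _ => shiftedTimes p).sum_comp,
      Fintype.sum_prod_type_right]
    refine Finset.sum_congr rfl fun w _ => ?_
    simp only [Fin.consEquiv_apply, List.ofFn_succ, Fin.cons_zero, Fin.cons_succ, List.foldr_cons,
      twistedDeriv, Finset.sum_add_distrib]
    congr 1
    rw [apply_ite (smoothFun.eval u), map_one, map_zero, ite_mul, one_mul, zero_mul,
      ← sum_shiftedTimes_ite]
    refine Finset.sum_congr rfl fun i _ => ?_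
    rw [((mem_shiftedTimes p i.1).1 i.2).2, PNat.one_coe, Nat.cast_one, add_sub_right_comm]

end TauFunction

end Times

section EMinus

variable {𝕜 : Type*} [RCLike 𝕜] [NormedAlgebra 𝕜 ℂ] {r : ℕ}

/-- The series `e_-^{(a)}(ε ∂/∂t, z) f` at the times `t`, as a power series in `z⁻¹`. -/
noncomputable def eMinusSeries (ε : ℤˣ) (a : Fin r) (f : Times 𝕜 r → ℂ) (t : Times 𝕜 r) : ℂ⟦X⟧ :=
  PowerSeries.mk fun n => eMinus ε a n f t

theorem eMinus_zero (ε : ℤˣ) (a : Fin r) (f : Times 𝕜 r → ℂ) : eMinus ε a 0 f = f := by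
  have : Subsingleton (Composition 0) := ⟨fun c d => Composition.ext <| by
    rw [c.blocks_eq_nil.2 rfl, d.blocks_eq_nil.2 rfl]⟩
  funext t
  have hblocks : (default : Composition 0).blocks = [] := (Composition.blocks_eq_nil _).2 rfl
  rw [eMinus, Fintype.sum_subsingleton _ default, Composition.length, hblocks]
  simp

end EMinus

namespace TauFunction

section Dressing

variable {𝕜 : Type*} [RCLike 𝕜] [NormedAlgebra 𝕜 ℂ] {r : ℕ} {k : ℤ} (τ : TauFunction 𝕜 r k)

theorem pairCoeff_apply (a : Fin r) (m' m'' : Fin r → ℤ) (t'' : Times 𝕜 r) (n : ℤ)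
    (t' : Times 𝕜 r) :
    τ.pairCoeff a m' m'' t'' n t' = (PDO.ofPowerSeries (eMinusSeries 1 a (τ.toFun m') t' *
      eMinusSeries (-1) a (τ.toFun m'') t'')).coeff n := by
  simp only [pairCoeff, PDO.coeff_ofPowerSeries, PowerSeries.coeff_mul, eMinusSeries,
    PowerSeries.coeff_mk]

theorem smoothInTimes_pairCoeff (a : Fin r) {m' : Fin r → ℤ} (hm' : ∑ b, m' b = k)
    (m'' : Fin r → ℤ) (t'' : Times 𝕜 r) (n : ℤ) :
    SmoothInTimes τ.domain (τ.pairCoeff a m' m'' t'' n) := by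
  intro t ht S
  unfold pairCoeff
  split_ifs
  · exact ContDiffAt.sum fun q _ =>
      ((τ.smooth m' hm').eMinus 1 a q.1 t ht S).mul contDiffAt_const
  · exact contDiffAt_const

/-- The sign `(-1)^{|e_a|_{b-1}}`. -/
def stdSign (a b : Fin r) : ℂ := if a < b then -1 else 1

theorem stdSign_mul_self (a b : Fin r) : stdSign a b * stdSign a b = 1 := by
  rw [stdSign]
  split_ifs <;> norm_num

theorem neg_one_zpow_sum_stdVec (m : Fin r → ℤ) (a b c : Fin r) :
    (-1 : ℂ) ^ (∑ d ∈ Finset.univ.filter (fun d => d < c), ((m + stdVec a) d + (m - stdVec b) d))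
      = stdSign a c * stdSign b c := by
  have hstdVec : ∀ e : Fin r, ∑ d ∈ Finset.univ.filter (fun d => d < c), stdVec e d
      = if e < c then 1 else 0 := fun e => by simp [stdVec, Pi.single_apply]
  have hsum : ∑ d ∈ Finset.univ.filter (fun d => d < c), ((m + stdVec a) d + (m - stdVec b) d)
      = 2 * (∑ d ∈ Finset.univ.filter (fun d => d < c), m d) + (if a < c then 1 else 0)
        - (if b < c then 1 else 0) := by
    rw [← hstdVec a, ← hstdVec b, Finset.mul_sum, ← Finset.sum_add_distrib,
      ← Finset.sum_sub_distrib]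
    exact Finset.sum_congr rfl fun d _ => by simp only [Pi.add_apply, Pi.sub_apply]; ring
  rw [hsum, zpow_sub₀ (by norm_num), zpow_add₀ (by norm_num), zpow_mul, stdSign, stdSign]
  split_ifs <;> norm_num

/-- The series `P^ε_{ab}(m, t, ε z)`, as a power series in `z⁻¹`. -/
noncomputable def dressingSeries (ε : ℤˣ) (m : Fin r → ℤ) (a b : Fin r) (t : Times 𝕜 r) : ℂ⟦X⟧ :=
  PowerSeries.mk fun n => (ε : ℤ) ^ n * τ.PCoeff ε m a b n t

variable {τ} {m : Fin r → ℤ}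

theorem C_mul_dressingSeries (ε : ℤˣ) (a b : Fin r) {t : Times 𝕜 r} (ht : τ.toFun m t ≠ 0) :
    PowerSeries.C (τ.toFun m t) * τ.dressingSeries ε m a b t
      = PowerSeries.C (stdSign a b) * (PowerSeries.X ^ (if a = b then 0 else 1) *
        eMinusSeries ε b (τ.toFun (m + (ε : ℤ) • (stdVec a - stdVec b))) t) := by
  ext n
  have hε : ((ε : ℤ) : ℂ) ^ n * ((ε : ℤ) : ℂ) ^ n = 1 := by
    rw [← mul_pow, ← Int.cast_mul, ← Units.val_mul, Int.units_mul_self]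
    simp
  rw [PowerSeries.coeff_C_mul, PowerSeries.coeff_C_mul, dressingSeries, PowerSeries.coeff_mk,
    PCoeff, ← mul_assoc (((ε : ℤ) : ℂ) ^ n), ← mul_assoc (((ε : ℤ) : ℂ) ^ n), hε, one_mul,
    mul_left_comm, mul_div_cancel₀ _ ht, stdSign]
  congr 1
  obtain hab | hab := eq_or_ne a b
  · simp [hab, eMinusSeries]
  · obtain _ | n := n <;> simp [hab, eMinusSeries, PowerSeries.coeff_succ_X_mul]

theorem pairCoeff_stdVec (a b c : Fin r) {x y : Times 𝕜 r} (hx : τ.toFun m x ≠ 0)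
    (hy : τ.toFun m y ≠ 0) (n : ℤ) :
    τ.pairCoeff c (m + stdVec a - stdVec c) (m - stdVec b + stdVec c) y
        (n + (2 - ((m + stdVec a) c - (m - stdVec b) c))) x
      = (PDO.ofPowerSeries (PowerSeries.C (stdSign a c * stdSign b c * τ.toFun m y) *
        (PowerSeries.C (τ.toFun m x) * τ.dressingSeries 1 m a c x *
          τ.dressingSeries (-1) m b c y))).coeff n := by
  have hshift : 2 - ((m + stdVec a) c - (m - stdVec b) c)
      = (((if a = c then 0 else 1) + (if b = c then 0 else 1) : ℕ) : ℤ) := by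
    simp only [Pi.add_apply, Pi.sub_apply, stdVec, Pi.single_apply, eq_comm (a := c)]
    split_ifs <;> simp
  have hsign : PowerSeries.C (stdSign a c * stdSign b c) *
      (PowerSeries.C (stdSign a c) * PowerSeries.C (stdSign b c)) = 1 := by
    rw [← map_mul, ← map_mul, mul_mul_mul_comm, stdSign_mul_self, stdSign_mul_self, mul_one,
      map_one]
  have hE := C_mul_dressingSeries 1 a c hx
  have hE' := C_mul_dressingSeries (-1) b c hy
  rw [Units.val_one, one_smul, ← add_sub_assoc] at hE
  rw [Units.val_neg, Units.val_one, neg_one_smul, ← sub_eq_add_neg, sub_sub_eq_add_sub,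
    add_sub_right_comm] at hE'
  rw [pairCoeff_apply, hshift, ← PDO.coeff_ofPowerSeries_X_pow_mul]
  congr 2
  have hfactor := congrArg₂ (fun f g => PowerSeries.C (stdSign a c * stdSign b c) * (f * g)) hE hE'
  rw [mul_mul_mul_comm (PowerSeries.C (stdSign a c)),
    ← mul_assoc _ (PowerSeries.C _ * PowerSeries.C _), hsign, one_mul] at hfactor
  rw [map_mul _ (stdSign a c * stdSign b c), pow_add, mul_mul_mul_comm, ← hfactor]
  simp only [mul_assoc, mul_left_comm]

end Dressing

section Reduced

variable {𝕜 : Type*} [RCLike 𝕜] [NormedAlgebra 𝕜 ℂ] {r : ℕ} [NeZero r] {k : ℤ}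
  (τ : TauFunction 𝕜 r k) (p : Fin r → ℕ) (m : Fin r → ℤ) (hm : ∑ a, m a = k) (t : Times 𝕜 r)

/-- The series `Q^ε_{ab}(ε z)`, as a power series in `z⁻¹`. -/
noncomputable def QSeries (ε : ℤˣ) (a b : Fin r) : (smoothFun (τ.region p m hm t))⟦X⟧ :=
  PowerSeries.mk fun n => (ε : ℤ) ^ n * τ.Q p m hm t ε a b n

theorem map_eval_QSeries (ε : ℤˣ) (a b : Fin r) (u : τ.region p m hm t) :
    (τ.QSeries p m hm t ε a b).map (smoothFun.eval u : _ →+* ℂ)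
      = τ.dressingSeries ε m a b (reducedTimes p t u) := by
  ext n
  rw [PowerSeries.coeff_map, QSeries, dressingSeries, PowerSeries.coeff_mk, PowerSeries.coeff_mk,
    map_mul, map_pow, map_intCast]
  rfl

theorem constantCoeff_QSeries (ε : ℤˣ) (a b : Fin r) :
    PowerSeries.constantCoeff (τ.QSeries p m hm t ε a b) = if a = b then 1 else 0 := by
  refine smoothFun.ext_eval fun u => ?_
  have h := congrArg (PowerSeries.coeff 0) (τ.map_eval_QSeries p m hm t ε a b u)
  rw [PowerSeries.coeff_map, PowerSeries.coeff_zero_eq_constantCoeff_apply] at h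
  refine h.trans ?_
  obtain rfl | hab := eq_or_ne a b
  · simp [dressingSeries, PCoeff, eMinus_zero, u.2.2]
  · simp [dressingSeries, PCoeff, hab]

/-- The function `τ^m` at the reduced times translated by `x`, as a smooth function of `x`. -/
noncomputable def tauFun : smoothFun (τ.region p m hm t) :=
  ⟨fun x => τ.toFun m (reducedTimes p t x), fun x => τ.toFun m (reducedTimes p t x), fun x hx =>
    (contDiffAt_reducedTimes (τ.smooth m hm) p t x hx.1).contDiffWithinAt, fun _ => rfl⟩

theorem isUnit_tauFun : IsUnit (τ.tauFun p m hm t) :=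
  IsUnit.of_mul_eq_one
    ⟨fun x => (τ.toFun m (reducedTimes p t x))⁻¹, fun x => (τ.toFun m (reducedTimes p t x))⁻¹,
      fun x hx => ((contDiffAt_reducedTimes (τ.smooth m hm) p t x hx.1).inv hx.2).contDiffWithinAt,
      fun _ => rfl⟩
    (smoothFun.ext_eval fun u => mul_inv_cancel₀ u.2.2)

theorem pairCoeff_reducedTimes (a b c : Fin r) (u y : τ.region p m hm t) (n : ℤ) :
    τ.pairCoeff c (m + stdVec a - stdVec c) (m - stdVec b + stdVec c) (reducedTimes p t y)
        (n + (2 - ((m + stdVec a) c - (m - stdVec b) c))) (reducedTimes p t u)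
      = smoothFun.eval u (algebraMap ℂ _ (stdSign a c * stdSign b c *
          τ.toFun m (reducedTimes p t y)) *
        (PDO.ofPowerSeries (PowerSeries.C (τ.tauFun p m hm t) * τ.QSeries p m hm t 1 a c *
          (τ.dressingSeries (-1) m b c (reducedTimes p t y)).map (algebraMap ℂ _))).coeff n) := by
  rw [pairCoeff_stdVec a b c u.2.2 y.2.2, PDO.coeff_ofPowerSeries_C_mul, map_mul,
    AlgHom.commutes, ← RingHom.coe_coe (smoothFun.eval u), PDO.map_coeff_ofPowerSeries,
    map_mul (PowerSeries.map _), map_mul (PowerSeries.map _), PowerSeries.map_C, map_eval_QSeries,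
    smoothFun.map_eval_map_algebraMap]
  rfl

end Reduced

section Bilinear

variable {𝕜 : Type*} [RCLike 𝕜] [NormedAlgebra 𝕜 ℂ] {r : ℕ} [NeZero r] {k : ℤ}
  {τ : TauFunction 𝕜 r k} {p : Fin r → ℕ} (m : Fin r → ℤ) (hm : ∑ a, m a = k) (t : Times 𝕜 r)

/-- The bilinear equation for `m' = m + e_a`, `m'' = m - e_b`, differentiated `N` times with respect
to the variable `x` of `t'` at `x = y`. -/
theorem IsPKdV.sum_eval_iterate_twist_eq_zero (hτ : τ.IsPKdV p) (ℓ : ℕ) (a b : Fin r) (N : ℕ)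
    (y : τ.region p m hm t) :
    ∑ c, smoothFun.eval y ((PDO.twist (if p c = p 0 then 1 else 0))^[N]
      (PDO.ofPowerSeries (PowerSeries.C (τ.tauFun p m hm t) * τ.QSeries p m hm t 1 a c *
        (τ.dressingSeries (-1) m b c (reducedTimes p t y)).map (algebraMap ℂ _))).coeff
      (-1 - ℓ * p c)) = 0 := by
  have hsum : ∀ c : Fin r, ∑ d, stdVec c d = 1 := fun c => by simp [stdVec]
  have hm' : ∑ d, (m + stdVec a) d = k + 1 := by
    simp only [Pi.add_apply, Finset.sum_add_distrib, hm, hsum]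
  have hm'' : ∑ d, (m - stdVec b) d = k - 1 := by
    simp only [Pi.sub_apply, Finset.sum_sub_distrib, hm, hsum]
  have hG := fun c n => τ.smoothInTimes_pairCoeff c (m' := m + stdVec a - stdVec c)
    (by simp only [Pi.sub_apply, Finset.sum_sub_distrib, hm', hsum, add_sub_cancel_right])
    (m - stdVec b + stdVec c) (reducedTimes p t y) n
  have hw := fun w : Fin N → shiftedTimes p =>
    hτ ℓ (m + stdVec a) (m - stdVec b) hm' hm'' (List.ofFn fun i => (w i).1) _ y.2.1
  have hτ' := Finset.sum_eq_zero fun w (_ : w ∈ Finset.univ) => hw w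
  rw [Finset.sum_comm] at hτ'
  refine (mul_eq_zero_iff_left y.2.2).1 ?_
  rw [Finset.mul_sum, ← hτ']
  refine Finset.sum_congr rfl fun c _ => ?_
  have h := eval_iterate_twist (fun u : τ.region p m hm t => u.2.1) c (hG c)
    (fun n u => (pairCoeff_reducedTimes τ p m hm t a b c u y n).symm) N (-1 - ℓ * p c) y
  rw [PDO.iterate_twist_const_mul (smoothFun.deriv_algebraMap _), map_mul, AlgHom.commutes] at h
  have hsign : stdSign a c * stdSign b c * (stdSign a c * stdSign b c) = 1 := by
    rw [mul_mul_mul_comm, stdSign_mul_self, stdSign_mul_self, one_mul]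
  have hindex : -1 - ((m + stdVec a) c - (m - stdVec b) c + ℓ * p c - 2)
      = -1 - ℓ * p c + (2 - ((m + stdVec a) c - (m - stdVec b) c)) := by ring
  rw [← Finset.mul_sum, neg_one_zpow_sum_stdVec, hindex, ← h, Algebra.algebraMap_self,
    RingHom.id_apply, ← mul_assoc, ← mul_assoc (_ * _), hsign, one_mul]

end Bilinear

end TauFunction

theorem PDO.IsDifferential.eq_add_plus_sub {R : Type*} [CommRing R] [Differential R] {a b : PDO R}
    (h : (a + b).IsDifferential) (c : PDO R) : a = c + (a.plus - c + b.plus) - b := by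
  have hplus := h.plus_eq
  rw [plus_add] at hplus
  rw [← add_assoc, add_sub_cancel, hplus, add_sub_cancel_right]

namespace TauFunction

section Reduced

variable {𝕜 : Type*} [RCLike 𝕜] [NormedAlgebra 𝕜 ℂ] {r : ℕ} [NeZero r] {k : ℤ}
  (τ : TauFunction 𝕜 r k) (p : Fin r → ℕ) (m : Fin r → ℤ) (hm : ∑ a, m a = k) (t : Times 𝕜 r)

theorem Q11_apply (a b : Top p) :
    τ.Q11 p m hm t a b = PDO.ofPowerSeries (τ.QSeries p m hm t 1 a b) := by
  rw [Q11, Matrix.of_apply, PDO.ofPowerSeries]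
  congr 1
  funext n
  rw [QSeries, PowerSeries.coeff_mk, Units.val_one, Int.cast_one, one_pow, one_mul]

/-- The formal adjoint of the operator `Q⁻₁₁(m, x, t, ∂)`. It turns out to be the inverse of
`Q⁺₁₁(m, x, t, ∂)`. -/
noncomputable def Q11Adj : Matrix (Top p) (Top p) (PDO (smoothFun (τ.region p m hm t))) :=
  Matrix.of fun c b => PDO.ofPowerSeriesRight (τ.QSeries p m hm t (-1) b c)

theorem Q11_sub_one_mem : τ.Q11 p m hm t - 1 ∈ (PDO.filtration _ (-1)).matrix := by
  intro a b
  have h := PDO.orderLE_ofPowerSeries_sub_C (τ.QSeries p m hm t 1 a b)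
  rw [constantCoeff_QSeries, apply_ite PDO.C, map_one, map_zero] at h
  simp only [SetLike.mem_coe, Matrix.sub_apply, Q11_apply, Matrix.one_apply, Subtype.ext_iff]
  exact h

theorem Q11Adj_sub_one_mem : τ.Q11Adj p m hm t - 1 ∈ (PDO.filtration _ (-1)).matrix := by
  intro c b
  have h := PDO.orderLE_ofPowerSeriesRight_sub_C (τ.QSeries p m hm t (-1) b c)
  rw [constantCoeff_QSeries, apply_ite PDO.C, map_one, map_zero] at h
  simp only [Matrix.sub_apply, Q11Adj, Matrix.of_apply, Matrix.one_apply, Subtype.ext_iff,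
    eq_comm (a := (c : Fin r))]
  exact h

theorem constantCoeff_QSeries_rest (ε : ℤˣ) (a : Top p) (c : Rest p) :
    PowerSeries.constantCoeff (τ.QSeries p m hm t ε a c) = 0 := by
  rw [constantCoeff_QSeries, if_neg]
  exact fun h => c.2 (h ▸ a.2)

theorem expCoeff_eq (i : ℕ) :
    τ.expCoeff p m hm t i
      = PowerSeries.coeff i (PDO.expSeries (-smoothFun.X (τ.region p m hm t))) := by
  rw [expCoeff, PDO.coeff_expSeries, ← Algebra.smul_def, one_div,
    ← Rat.cast_smul_eq_qsmul ℂ, Rat.cast_inv, Rat.cast_natCast]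

theorem W12_apply (a : Top p) (c : Rest p) :
    τ.W12 p m hm t a c = PDO.leftTruncation (p c)
      (PDO.expSeries (-smoothFun.X (τ.region p m hm t)) * τ.QSeries p m hm t 1 a c) := by
  rw [PDO.leftTruncation_expSeries_mul _ (τ.constantCoeff_QSeries_rest p m hm t 1 a c), W12,
    Matrix.of_apply]
  simp only [expCoeff_eq, QSeries, PowerSeries.coeff_mk, Units.val_one, Int.cast_one, one_pow,
    one_mul]

theorem W21_apply (c : Rest p) (b : Top p) :
    τ.W21 p m hm t c b = PDO.rightTruncation (p c)
      (PDO.expSeries (smoothFun.X (τ.region p m hm t)) * τ.QSeries p m hm t (-1) b c) := by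
  have hQ : τ.QSeries p m hm t (-1) b c
      = PowerSeries.rescale (-1) (PowerSeries.mk (τ.Q p m hm t (-1) b c)) := by
    ext1 n
    rw [QSeries, PowerSeries.coeff_rescale, PowerSeries.coeff_mk, PowerSeries.coeff_mk]
    simp
  have h := τ.constantCoeff_QSeries_rest p m hm t (-1) b c
  rw [hQ, PDO.constantCoeff_rescale] at h
  rw [hQ, PDO.rightTruncation_expSeries_mul_rescale_neg_one _ h, W21, Matrix.of_apply]
  simp only [expCoeff_eq, PowerSeries.coeff_mk]
  rfl

theorem isDifferential_leadingTerm (a b : Top p) :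
    (τ.leadingTerm p m hm t a b).IsDifferential := by
  rw [leadingTerm, Matrix.diagonal_apply]
  split_ifs
  exacts [PDO.isDifferential_monomial (by omega) _, zero_mem (PDO.differentialSubring _)]

theorem leadingTerm_mem : τ.leadingTerm p m hm t ∈ (PDO.filtration _ (p 0)).matrix := by
  intro a b
  rw [leadingTerm, Matrix.diagonal_apply]
  split_ifs
  exacts [PDO.orderLE_monomial _ _, zero_mem (PDO.filtration _ _)]

theorem isDifferential_W12 (a : Top p) (c : Rest p) : (τ.W12 p m hm t a c).IsDifferential := by
  rw [W12_apply]
  exact PDO.isDifferential_leftTruncation _ _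

theorem isDifferential_W21 (c : Rest p) (b : Top p) : (τ.W21 p m hm t c b).IsDifferential := by
  rw [W21_apply]
  exact PDO.isDifferential_rightTruncation _ _

theorem isDifferential_W11 (a b : Top p) : (τ.W11 p m hm t a b).IsDifferential :=
  (PDO.differentialSubring _).add_mem
    ((PDO.differentialSubring _).sub_mem (PDO.isDifferential_plus _)
      (τ.isDifferential_leadingTerm p m hm t a b))
    (PDO.isDifferential_plus _)

theorem orderLE_W12 (a : Top p) (c : Rest p) : (τ.W12 p m hm t a c).OrderLE (p c - 1) := by
  rw [W12_apply]
  exact PDO.orderLE_leftTruncation _ _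

theorem orderLE_W21 (c : Rest p) (b : Top p) : (τ.W21 p m hm t c b).OrderLE (p c - 1) := by
  rw [W21_apply]
  exact PDO.orderLE_rightTruncation _ _

variable {p}

theorem orderLE_W12_mul_middle_mul_W21 (hmax : ∀ c, p c ≤ p 0) (a b : Top p) :
    ((τ.W12 p m hm t * τ.middle p m hm t * τ.W21 p m hm t) a b).OrderLE (p 0 - 1) := by
  rw [Matrix.mul_apply]
  refine sum_mem (S := PDO.filtration _ _) fun c _ => ?_
  rw [middle, Matrix.mul_diagonal]
  have := hmax c
  exact (((τ.orderLE_W12 p m hm t a c).mul (PDO.orderLE_monomial _ _)).mul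
    (τ.orderLE_W21 p m hm t c b)).mono (by omega)

end Reduced

section Bilinear

variable {𝕜 : Type*} [RCLike 𝕜] [NormedAlgebra 𝕜 ℂ] {r : ℕ} [NeZero r] {k : ℤ}
  {τ : TauFunction 𝕜 r k} {p : Fin r → ℕ} (m : Fin r → ℤ) (hm : ∑ a, m a = k) (t : Times 𝕜 r)

/-- Times `∂^N` and at `x = y`, the coefficient of `∂⁻¹` of the `c`-th summand becomes the `c`-th
residue of the bilinear equation. Differentiating in `t'` alone, one may replace the coefficients
of the right hand factor by their values at `y`. -/
theorem IsPKdV.isDifferential_sum_add_sum (hτ : τ.IsPKdV p) (ℓ : ℕ) (a b : Fin r) :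
    (∑ c : Top p, PDO.ofPowerSeries (τ.QSeries p m hm t 1 a c) * PDO.monomial (ℓ * p 0) 1 *
        PDO.ofPowerSeriesRight (τ.QSeries p m hm t (-1) b c)
      + ∑ c : Rest p, PowerSeries.coeff (ℓ * p c + 1) (PDO.invSandwich
        (τ.QSeries p m hm t 1 a c) (τ.QSeries p m hm t (-1) b c))).IsDifferential := by
  refine PDO.IsDifferential.of_C_mul (τ.isUnit_tauFun p m hm t)
    (PDO.isDifferential_of_coeff_neg_one fun N => smoothFun.ext_eval fun y => ?_)
  rw [map_zero, ← hτ.sum_eval_iterate_twist_eq_zero m hm t ℓ a b N y,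
    ← Fintype.sum_subtype_add_sum_subtype (fun c => p c = p 0)]
  have hg : ∀ c, (τ.QSeries p m hm t (-1) b c).map (smoothFun.eval y : _ →+* ℂ)
      = ((τ.dressingSeries (-1) m b c (reducedTimes p t y)).map
        (algebraMap ℂ (smoothFun (τ.region p m hm t)))).map (smoothFun.eval y : _ →+* ℂ) := by
    intro c
    rw [map_eval_QSeries, smoothFun.map_eval_map_algebraMap]
  have hg' : ∀ c n, Differential.deriv (PowerSeries.coeff n
      ((τ.dressingSeries (-1) m b c (reducedTimes p t y)).map (algebraMap ℂ
        (smoothFun (τ.region p m hm t))))) = 0 := fun c n => by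
    rw [PowerSeries.coeff_map, smoothFun.deriv_algebraMap]
  simp only [mul_add, Finset.mul_sum, PDO.coeff_add, PDO.coeff_sum, map_add, map_sum]
  congr 1 <;> refine Finset.sum_congr rfl fun c _ => ?_
  · rw [if_pos c.2, c.2, ← mul_assoc (PDO.C _), ← mul_assoc (PDO.C _), PDO.C_mul_ofPowerSeries]
    exact PDO.map_coeff_neg_one_D_pow_mul_ofPowerSeries_mul _ (hg c) (hg' c) N _ _
  · rw [if_neg c.2, PDO.C_mul_coeff_invSandwich, show (-1 - ℓ * p c : ℤ) = -(ℓ * p c + 1 : ℕ) by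
      push_cast; ring]
    exact PDO.map_coeff_neg_one_D_pow_mul_coeff_invSandwich _ (hg c) (hg' c) N _ _

theorem IsPKdV.Q11_mul_Q11Adj (hτ : τ.IsPKdV p) : τ.Q11 p m hm t * τ.Q11Adj p m hm t = 1 := by
  refine PDO.mul_eq_one_of_isDifferential (τ.Q11_sub_one_mem p m hm t)
    (τ.Q11Adj_sub_one_mem p m hm t) fun a b => ?_
  have hrest : ∀ c : Rest p, PowerSeries.coeff 1 (PDO.invSandwich
      (τ.QSeries p m hm t 1 a c) (τ.QSeries p m hm t (-1) b c)) = 0 := fun c => by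
    simp [PDO.coeff_invSandwich, Finset.Nat.antidiagonal_succ, constantCoeff_QSeries_rest]
  have h := hτ.isDifferential_sum_add_sum m hm t 0 a b
  simp only [Nat.cast_zero, zero_mul, zero_add, hrest, Finset.sum_const_zero, add_zero,
    ← PDO.C_apply, map_one, mul_one] at h
  rw [Matrix.mul_apply]
  simp only [Q11_apply, Q11Adj, Matrix.of_apply]
  exact h

theorem IsPKdV.Q11Adj_mul_Q11 (hτ : τ.IsPKdV p) : τ.Q11Adj p m hm t * τ.Q11 p m hm t = 1 :=
  PDO.mul_eq_one_symm (τ.Q11_sub_one_mem p m hm t) (τ.Q11Adj_sub_one_mem p m hm t)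
    (hτ.Q11_mul_Q11Adj m hm t)

theorem IsPKdV.isUnit_Q11 (hτ : τ.IsPKdV p) : IsUnit (τ.Q11 p m hm t) :=
  ⟨⟨_, _, hτ.Q11_mul_Q11Adj m hm t, hτ.Q11Adj_mul_Q11 m hm t⟩, rfl⟩

theorem IsPKdV.laxTilde_eq (hτ : τ.IsPKdV p) (hp : p 0 ≠ 0) :
    τ.laxTilde p m hm t = τ.Q11 p m hm t * τ.leadingTerm p m hm t * τ.Q11Adj p m hm t := by
  have hinv : Ring.inverse (τ.Q11 p m hm t) = τ.Q11Adj p m hm t :=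
    Ring.inverse_unit ⟨_, _, hτ.Q11_mul_Q11Adj m hm t, hτ.Q11Adj_mul_Q11 m hm t⟩
  simp only [laxTilde, lax, hinv, leadingTerm, ← PDO.coe_D_pow]
  exact sum_mul_single_mul_pow (hτ.Q11Adj_mul_Q11 m hm t) _ hp

theorem IsPKdV.isDifferential_laxTilde_add (hτ : τ.IsPKdV p) (hp : p 0 ≠ 0) (a b : Top p) :
    (τ.laxTilde p m hm t a b
      + (τ.W12 p m hm t * τ.middle p m hm t * τ.W21 p m hm t) a b).IsDifferential := by
  have hlax := hτ.isDifferential_sum_add_sum m hm t 1 a b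
  have hrest := sum_mem (S := PDO.differentialSubring _) fun (c : Rest p) (_ : c ∈ Finset.univ) =>
    PDO.isDifferential_leftTruncation_mul_sub_coeff_invSandwich smoothFun.deriv_X
      (τ.constantCoeff_QSeries_rest p m hm t 1 a c)
      (τ.constantCoeff_QSeries_rest p m hm t (-1) b c) (p c)
  have h := add_mem hlax hrest
  simp only [Nat.cast_one, one_mul] at h
  rw [Finset.sum_sub_distrib, add_add_sub_cancel] at h
  rw [hτ.laxTilde_eq m hm t hp, Matrix.mul_apply, Matrix.mul_apply]
  simp only [leadingTerm, middle, Matrix.mul_diagonal, Q11_apply, Q11Adj, Matrix.of_apply,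
    W12_apply, W21_apply]
  exact h

theorem IsPKdV.orderLE_plus_laxTilde_sub (hτ : τ.IsPKdV p) (hp : p 0 ≠ 0) (a b : Top p) :
    ((τ.laxTilde p m hm t a b).plus - τ.leadingTerm p m hm t a b).OrderLE (p 0 - 1) := by
  have h : (τ.laxTilde p m hm t a b - τ.leadingTerm p m hm t a b).OrderLE (p 0 - 1) := by
    rw [hτ.laxTilde_eq m hm t hp]
    exact PDO.mul_mul_sub_mem_matrix_filtration (τ.Q11_sub_one_mem p m hm t)
      (τ.leadingTerm_mem p m hm t) (τ.Q11Adj_sub_one_mem p m hm t) a b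
  rw [← sub_add_cancel (τ.laxTilde p m hm t a b) (τ.leadingTerm p m hm t a b), PDO.plus_add,
    (τ.isDifferential_leadingTerm p m hm t a b).plus_eq, add_sub_cancel_right]
  exact h.plus

theorem IsPKdV.orderLE_W11 (hτ : τ.IsPKdV p) (hmax : ∀ c, p c ≤ p 0) (hp : p 0 ≠ 0)
    (a b : Top p) : (τ.W11 p m hm t a b).OrderLE (p 0 - 1) :=
  (hτ.orderLE_plus_laxTilde_sub m hm t hp a b).add
    (τ.orderLE_W12_mul_middle_mul_W21 m hm t hmax a b).plus

end Bilinear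

end TauFunction

theorem mainTheorem5_general {𝕜 : Type*} [RCLike 𝕜] [NormedAlgebra 𝕜 ℂ] {r : ℕ} [NeZero r]
    (p : Fin r → ℕ) (hmax : ∀ a, p a ≤ p 0) (hp : p 0 ≠ 0)
    {k : ℤ} (τ : TauFunction 𝕜 r k) (hτ : τ.IsPKdV p)
    (m : Fin r → ℤ) (hm : ∑ a, m a = k) (t : Times 𝕜 r) :
    IsUnit (τ.Q11 p m hm t) ∧
    τ.laxTilde p m hm t =
      τ.leadingTerm p m hm t + τ.W11 p m hm t -
        τ.W12 p m hm t * τ.middle p m hm t * τ.W21 p m hm t ∧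
    (∀ a b, (τ.W12 p m hm t a b).IsDifferential ∧
      (τ.W12 p m hm t a b).OrderLE (min (p a : ℤ) (p b : ℤ) - 1)) ∧
    (∀ a b, (τ.W21 p m hm t a b).IsDifferential ∧
      (τ.W21 p m hm t a b).OrderLE (min (p a : ℤ) (p b : ℤ) - 1)) ∧
    (∀ a b, (τ.W11 p m hm t a b).IsDifferential ∧
      (τ.W11 p m hm t a b).OrderLE ((p 0 : ℤ) - 1)) := by
  have hmin (a : TauFunction.Top p) (c : TauFunction.Rest p) : min (p a : ℤ) (p c) = p c :=
    min_eq_right (by rw [a.2]; exact_mod_cast hmax c)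
  refine ⟨hτ.isUnit_Q11 m hm t, ?_, fun a b => ⟨τ.isDifferential_W12 p m hm t a b, ?_⟩,
    fun a b => ⟨τ.isDifferential_W21 p m hm t a b, ?_⟩,
    fun a b => ⟨τ.isDifferential_W11 p m hm t a b, hτ.orderLE_W11 m hm t hmax hp a b⟩⟩
  · ext1 a b
    exact (hτ.isDifferential_laxTilde_add m hm t hp a b).eq_add_plus_sub _
  · rw [hmin]
    exact τ.orderLE_W12 p m hm t a b
  · rw [min_comm, hmin]
    exact τ.orderLE_W21 p m hm t a b

theorem mainTheorem5 {𝕜 : Type*} [RCLike 𝕜] [NormedAlgebra 𝕜 ℂ] {r : ℕ} [NeZero r]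
    (p : Fin r → ℕ) (hanti : Antitone p) (hpos : ∀ a, 0 < p a) (hp : 1 < p 0)
    {k : ℤ} (τ : TauFunction 𝕜 r k) (hτ : τ.IsPKdV p)
    (m : Fin r → ℤ) (hm : ∑ a, m a = k) (t : Times 𝕜 r) :
    IsUnit (τ.Q11 p m hm t) ∧
    τ.laxTilde p m hm t =
      τ.leadingTerm p m hm t + τ.W11 p m hm t -
        τ.W12 p m hm t * τ.middle p m hm t * τ.W21 p m hm t ∧
    (∀ a b, (τ.W12 p m hm t a b).IsDifferential ∧
      (τ.W12 p m hm t a b).OrderLE (min (p a : ℤ) (p b : ℤ) - 1)) ∧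
    (∀ a b, (τ.W21 p m hm t a b).IsDifferential ∧
      (τ.W21 p m hm t a b).OrderLE (min (p a : ℤ) (p b : ℤ) - 1)) ∧
    (∀ a b, (τ.W11 p m hm t a b).IsDifferential ∧
      (τ.W11 p m hm t a b).OrderLE ((p 0 : ℤ) - 1)) :=
  mainTheorem5_general p (fun a => hanti (Fin.zero_le a)) (by omega) τ hτ m hm t
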